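/- **Lemma (Bhattacharyya single-step bounds for the trimmed deletion channel).** *Notation.* For a random bit $A$ and a discrete random variable $B$, let $Z(A|B)=2\sum_b\sqrt{\mathbb P(A=0,B=b)\,\mathbb P(A=1,B=b)}$. For a binary word $\mathbf y$, $\mathbf y^*$ denotes $\mathbf y$ with all leading and trailing zeros removed, and $\odot$ denotes concatenation. The deletion channel deletes each input bit independently with probability $\delta\in(0,1)$; the trimmed deletion channel (TDC) outputs $\mathbf Y^*$, where $\mathbf Y$ is the output of the deletion channel. The two halves of a word $\mathbf X$ of length $N=2^n$ are $\mathbf X_{I}$ and $\mathbf X_{II}$. For $\xi\in(0,\tfrac16)$ let $\ell_n=\lfloor 2^{(1-\xi)(n-1)}\rfloor$, and define $g(\mathbf X)=g(\mathbf X,n_0,\xi)$ recursively: $g(\mathbf X)=\mathbf X$ if $n\le n_0$, and $g(\mathbf X)=g(\mathbf X_I)\odot 0^{\ell_n}\odot g(\mathbf X_{II})$ if $n>n_0$. The Arıkan transform $\mathbf U=\mathcal A(\mathbf X)$ is the identity for $n=0$, and for $n\ge 1$, with $\mathbf V=\mathcal A(\mathbf X_I)$ and $\mathbf V'=\mathcal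 A(\mathbf X_{II})$, it is given by $U_{2j-1}=V_j+V'_j$ and $U_{2j}=V'_j$ modulo 2. A hidden-Markov input distribution is given by a finite state set $\mathcal S$, a law of the initial state $S_0$ and transition probabilities $\mathbb P(S_t=s',X_t=b\mid S_{t-1}=s)$, where $X_t$ is the emitted bit. It is regular if the chain $(S_t)$ is irreducible, aperiodic and stationary, and non-degenerate if $\mathbb P(X_1=1)>0$, i.e. if the process is not almost surely identically zero. *Statement.* Let $\xi\in(0,\frac16)$. There is a threshold $m_0^{\mathrm{th}}(\xi)$, depending on $\xi$ only, and for every regular, non-degenerate hidden-Markov input distribution and every $\delta\in(0,1)$ there is a threshold $m^{\mathrm{th}}$, depending on $\xi$, $\delta$ and the input distribution, such that the following holds for all $n_0\ge m_0^{\mathrm{th}}$ and all $n\ge\max\{m^{\mathrm{th}},n_0+1\}$. Let $\mathbf X$ have length $N=2^n$ and consist of i.i.d. blocks of length $2^{n_0}$, each distributed according to the input distribution, let $\mathbf U=\mathcal A(\mathbf X)$ and $\mathbf V=\mathcal A(\mathbf X_I)$, and let $\mathbf Y^*=\mathbf Z_I\odot\mathbf Z_\Delta\odot\mathbf Z_{II}$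 be the output of the TDC for the input $g(\mathbf X,n_0,\xi)$, where $\mathbf Z_I,\mathbf Z_\Delta,\mathbf Z_{II}$ are the parts of $\mathbf Y^*$ that originate from $g(\mathbf X_I)$, from the guard-band $0^{\ell_n}$ and from $g(\mathbf X_{II})$, respectively. Write $\mathbf Z^*_I=(\mathbf Z_I)^*$ and $\mathbf Z^*_{II}=(\mathbf Z_{II})^*$. Then for all $1\le i\le N$, with $j=\lfloor (i+1)/2\rfloor$ and with $b_n\in\{0,1\}$ the parity of $i-1$ (the last bit of its binary expansion), $$Z(U_i|U_1^{i-1},\mathbf Y^*)\ \le\ \tfrac32 N\cdot Z(U_i|U_1^{i-1},\mathbf Z_I^*,\mathbf Z_{II}^*)+2^{-N^{2/3}}$$ $$\le\ \begin{cases}\tfrac32N\cdot 2\cdot Z(V_j|V_1^{j-1},\mathbf Z_I^*)+2^{-N^{2/3}} & \text{if } b_n=0\ (\text{'$-$'}),\\ \tfrac32N\cdot Z(V_j|V_1^{j-1},\mathbf Z_I^*)^2+2^{-N^{2/3}} & \text{if } b_n=1\ (\text{'$+$'}).\end{cases}$$ -/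

import Mathlib

/-- A hidden-Markov source of bits with finite state set `S`. The state sequence
`S₀, S₁, S₂, …` starts from `init`, and `kernel s s' b` is the conditional probability
`P(S_t = s', X_t = b | S_{t-1} = s)` of moving from `s` to `s'` while emitting the bit `b`. -/
structure HiddenMarkov (S : Type*) [Fintype S] where
  init : S → ℝ
  kernel : S → S → Bool → ℝ
  init_nonneg : ∀ s, 0 ≤ init s
  init_sum : ∑ s, init s = 1
  kernel_nonneg : ∀ s s' b, 0 ≤ kernel s s' b
  kernel_sum : ∀ s, ∑ s', ∑ b, kernel s s' b = 1

namespace HiddenMarkov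

variable {S : Type*} [Fintype S]

/-- The transition matrix of the underlying chain of states. -/
def trans (H : HiddenMarkov S) : Matrix S S ℝ :=
  Matrix.of fun s s' => ∑ b, H.kernel s s' b

/-- `P((X₁, …, X_L) = w | S₀ = s)`, where `L` is the length of the word `w`. -/
def wordProbFrom (H : HiddenMarkov S) : List Bool → S → ℝ
  | [], _ => 1
  | b :: w, s => ∑ s', H.kernel s s' b * wordProbFrom H w s'

/-- `P((X₁, …, X_L) = w)`, where `L` is the length of the word `w`. -/
noncomputable def wordProb (H : HiddenMarkov S) (w : List Bool) : ℝ :=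
  ∑ s, H.init s * H.wordProbFrom w s

open Classical in
/-- A regular hidden-Markov source: the chain of states is irreducible, aperiodic and stationary. -/
structure IsRegular (H : HiddenMarkov S) : Prop where
  irreducible : H.trans.IsIrreducible
  aperiodic : ∀ (s : S) (d : ℕ), (∀ k : ℕ, 0 < k → 0 < (H.trans ^ k) s s → d ∣ k) → d = 1
  stationary : ∀ s', ∑ s, H.init s * H.trans s s' = H.init s'

/-- A stationary source is non-degenerate if it does not almost surely emit zeros only, that is,
if `P(X₁ = 1) > 0`. -/
def NonDegenerate (H : HiddenMarkov S) : Prop :=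
  0 < H.wordProb [true]

end HiddenMarkov

namespace TDC

/-- The first half `x_I` of a word of length `2 ^ (n + 1)`. -/
def firstHalf {n : ℕ} (x : Fin (2 ^ (n + 1)) → Bool) : Fin (2 ^ n) → Bool :=
  fun k => x ⟨k, by have := k.2; rw [pow_succ]; omega⟩

/-- The second half `x_II` of a word of length `2 ^ (n + 1)`. -/
def secondHalf {n : ℕ} (x : Fin (2 ^ (n + 1)) → Bool) : Fin (2 ^ n) → Bool :=
  fun k => x ⟨2 ^ n + k, by have := k.2; rw [pow_succ]; omega⟩

/-- With indices counted from zero, the position `⌊i / 2⌋` in a half that corresponds to the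
position `i` in the full vector. Counted from one, this is the map `i ↦ ⌊(i + 1) / 2⌋`. -/
def halfIndex {n : ℕ} (i : Fin (2 ^ (n + 1))) : Fin (2 ^ n) :=
  ⟨i / 2, by have h : (i : ℕ) < 2 ^ (n + 1) := i.2; have := pow_succ 2 n; omega⟩

/-- The Arıkan transform. With `V` and `V'` the transforms of the two halves, and with indices
counted from one, `U_{2j-1} = V_j + V'_j` and `U_{2j} = V'_j` modulo 2. -/
def arikan : (n : ℕ) → (Fin (2 ^ n) → Bool) → (Fin (2 ^ n) → Bool)
  | 0, x => x
  | n + 1, x => fun i =>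
      if (i : ℕ) % 2 = 0 then
        xor (arikan n (firstHalf x) (halfIndex i)) (arikan n (secondHalf x) (halfIndex i))
      else arikan n (secondHalf x) (halfIndex i)

/-- The coordinates of `u` that precede the coordinate `i`. -/
def past {N : ℕ} (u : Fin N → Bool) (i : Fin N) : List Bool :=
  (List.ofFn u).take i

/-- The guard-band length `ℓ_n = ⌊2 ^ ((1 - ξ) (n - 1))⌋`. -/
noncomputable def guardLen (ξ : ℝ) (n : ℕ) : ℕ :=
  ⌊(2 : ℝ) ^ ((1 - ξ) * ((n : ℝ) - 1))⌋₊

/-- The word `g(x, n₀, ξ)`: guard-bands of zeros are added recursively between the two halves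
of `x`, down to blocks of length `2 ^ n₀`. -/
noncomputable def addGuards (ξ : ℝ) (n₀ : ℕ) : (n : ℕ) → (Fin (2 ^ n) → Bool) → List Bool
  | 0, x => List.ofFn x
  | n + 1, x =>
      if n + 1 ≤ n₀ then List.ofFn x
      else addGuards ξ n₀ n (firstHalf x) ++ List.replicate (guardLen ξ (n + 1)) false ++
        addGuards ξ n₀ n (secondHalf x)

/-- The length of `g(x, n₀, ξ)` for a word `x` of length `2 ^ n`. -/
noncomputable def fullLen (ξ : ℝ) (n₀ : ℕ) : ℕ → ℕ
  | 0 => 1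
  | n + 1 =>
      if n + 1 ≤ n₀ then 2 ^ (n + 1)
      else fullLen ξ n₀ n + guardLen ξ (n + 1) + fullLen ξ n₀ n

theorem length_addGuards (ξ : ℝ) (n₀ n : ℕ) (x : Fin (2 ^ n) → Bool) :
    (addGuards ξ n₀ n x).length = fullLen ξ n₀ n := by
  induction n with
  | zero => simp [addGuards, fullLen]
  | succ n ih =>
    unfold addGuards fullLen
    split_ifs <;> simp [ih, add_assoc]

/-- The probability of `X = x`, where `X` has length `2 ^ n` and, for `n₀ ≤ n`, consists of
`2 ^ (n - n₀)` independent blocks of length `2 ^ n₀`, each distributed according to the source. -/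
noncomputable def inputProb {S : Type*} [Fintype S] (H : HiddenMarkov S) (n₀ : ℕ) :
    (n : ℕ) → (Fin (2 ^ n) → Bool) → ℝ
  | 0, x => H.wordProb (List.ofFn x)
  | n + 1, x =>
      if n + 1 ≤ n₀ then H.wordProb (List.ofFn x)
      else inputProb H n₀ n (firstHalf x) * inputProb H n₀ n (secondHalf x)

/-- The sample space: the input word `X` and the deletion pattern of the channel, in which the
value `true` at `k` means that the symbol at position `k` of `g(X, n₀, ξ)` is deleted. -/
abbrev Outcome (ξ : ℝ) (n₀ n : ℕ) : Type :=
  (Fin (2 ^ n) → Bool) × (Fin (fullLen ξ n₀ n) → Bool)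

/-- The probability of an outcome: the deletions are independent of each other and of the input,
and each has probability `δ`. -/
noncomputable def outcomeProb {S : Type*} [Fintype S] (H : HiddenMarkov S) (δ ξ : ℝ) (n₀ n : ℕ)
    (ω : Outcome ξ n₀ n) : ℝ :=
  inputProb H n₀ n ω.1 * ∏ k, if ω.2 k then δ else 1 - δ

/-- The symbols of `w` that survive the deletion pattern `d`. -/
def survivors (w d : List Bool) : List Bool :=
  ((w.zip d).filter fun p => !p.2).map Prod.fst

/-- The trimming channel: all leading and all trailing zeros are removed. -/
def trim (y : List Bool) : List Bool :=
  (y.dropWhile fun b => !b).rdropWhile fun b => !b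

/-- The part of the trimmed word `(a ++ b ++ c)*` that originates from `b`. -/
def trimmedPart (a b c : List Bool) : List Bool :=
  let y := a ++ b ++ c
  let lead := (y.takeWhile fun t => !t).length
  let trail := (y.rtakeWhile fun t => !t).length
  (b.take (y.length - trail - a.length)).drop (lead - a.length)

/-- The output `Y*` of the trimmed deletion channel for the input `g(X, n₀, ξ)`. -/
noncomputable def outYstar {ξ : ℝ} {n₀ n : ℕ} (ω : Outcome ξ n₀ n) : List Bool :=
  trim (survivors (addGuards ξ n₀ n ω.1) (List.ofFn ω.2))

/-- `Y_I`, the part of the deletion channel output that originates from `G_I = g(X_I)`. -/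
noncomputable def outYI {ξ : ℝ} {n₀ n : ℕ} (ω : Outcome ξ n₀ (n + 1)) : List Bool :=
  survivors (addGuards ξ n₀ n (firstHalf ω.1)) ((List.ofFn ω.2).take (fullLen ξ n₀ n))

/-- `Y_Δ`, the part of the deletion channel output that originates from the outermost
guard-band. -/
noncomputable def outYΔ {ξ : ℝ} {n₀ n : ℕ} (ω : Outcome ξ n₀ (n + 1)) : List Bool :=
  survivors (List.replicate (guardLen ξ (n + 1)) false)
    (((List.ofFn ω.2).drop (fullLen ξ n₀ n)).take (guardLen ξ (n + 1)))

/-- `Y_II`, the part of the deletion channel output that originates from `G_II = g(X_II)`. -/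
noncomputable def outYII {ξ : ℝ} {n₀ n : ℕ} (ω : Outcome ξ n₀ (n + 1)) : List Bool :=
  survivors (addGuards ξ n₀ n (secondHalf ω.1))
    ((List.ofFn ω.2).drop (fullLen ξ n₀ n + guardLen ξ (n + 1)))

/-- `Z_I`, the part of `Y*` that originates from `G_I`. -/
noncomputable def outZI {ξ : ℝ} {n₀ n : ℕ} (ω : Outcome ξ n₀ (n + 1)) : List Bool :=
  trimmedPart [] (outYI ω) (outYΔ ω ++ outYII ω)

/-- `Z_Δ`, the part of `Y*` that originates from the outermost guard-band. -/
noncomputable def outZΔ {ξ : ℝ} {n₀ n : ℕ} (ω : Outcome ξ n₀ (n + 1)) : List Bool :=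
  trimmedPart (outYI ω) (outYΔ ω) (outYII ω)

/-- `Z_II`, the part of `Y*` that originates from `G_II`. -/
noncomputable def outZII {ξ : ℝ} {n₀ n : ℕ} (ω : Outcome ξ n₀ (n + 1)) : List Bool :=
  trimmedPart (outYI ω ++ outYΔ ω) (outYII ω) []

open Classical in
/-- The probability of an event on a finite sample space with point probabilities `p`. -/
noncomputable def prob {Ω : Type*} [Fintype Ω] (p : Ω → ℝ) (E : Ω → Prop) : ℝ :=
  ∑ ω, if E ω then p ω else 0

open Classical in
/-- The Bhattacharyya parameter
`Z(A | B) = 2 ∑_b √(P(A = 0, B = b) P(A = 1, B = b))` of a random bit `A` given `B`. The sum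
runs over the finitely many values of `B`. -/
noncomputable def bhattacharyya {Ω β : Type*} [Fintype Ω] (p : Ω → ℝ) (A : Ω → Bool)
    (B : Ω → β) : ℝ :=
  2 * ∑ b ∈ Finset.univ.image B,
    √(prob p (fun ω => A ω = false ∧ B ω = b) * prob p (fun ω => A ω = true ∧ B ω = b))

/-- `Z(U_i | U_1^{i-1}, Y*)` for `U = 𝒜(X)`, with `X` of length `2 ^ n`. -/
noncomputable def zFull {S : Type*} [Fintype S] (H : HiddenMarkov S) (δ ξ : ℝ) (n₀ n : ℕ)
    (i : Fin (2 ^ n)) : ℝ :=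
  bhattacharyya (outcomeProb H δ ξ n₀ n) (fun ω => arikan n ω.1 i)
    (fun ω => (past (arikan n ω.1) i, outYstar ω))

/-- `Z(U_i | U_1^{i-1}, Z_I*, Z_II*)` for `U = 𝒜(X)`, with `X` of length `2 ^ (n + 1)`. -/
noncomputable def zPair {S : Type*} [Fintype S] (H : HiddenMarkov S) (δ ξ : ℝ) (n₀ n : ℕ)
    (i : Fin (2 ^ (n + 1))) : ℝ :=
  bhattacharyya (outcomeProb H δ ξ n₀ (n + 1)) (fun ω => arikan (n + 1) ω.1 i)
    (fun ω => (past (arikan (n + 1) ω.1) i, trim (outZI ω), trim (outZII ω)))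

/-- `Z(V_j | V_1^{j-1}, Z_I*)` for `V = 𝒜(X_I)`, with `X` of length `2 ^ (n + 1)`. -/
noncomputable def zHalf {S : Type*} [Fintype S] (H : HiddenMarkov S) (δ ξ : ℝ) (n₀ n : ℕ)
    (j : Fin (2 ^ n)) : ℝ :=
  bhattacharyya (outcomeProb H δ ξ n₀ (n + 1)) (fun ω => arikan n (firstHalf ω.1) j)
    (fun ω => (past (arikan n (firstHalf ω.1)) j, trim (outZI ω)))

end TDC

/-! The point is that `Y*` almost determines the pair `(Z_I*, Z_II*)`: cut `Y*` at its midpoint and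
trim both pieces. This recovers the pair whenever the midpoint falls inside the surviving
guard-band. Data processing then bounds `Z(U_i | U_1^{i-1}, Y*)` by the parameter given the cut, and
changing an observation on an event of probability `ε` costs at most `6√ε`. So the first inequality
even holds with coefficient 1 in place of `3N/2`.

The cut can fail for three reasons, each treated by an exponential estimate with `ℓ` the guard
length. No `1` survives close to the left end of `Y_I` or the right end of `Y_II`, so that trimming
shifts the midpoint too far (`exists_ones_decay`, `prob_no_true_take_le`,
`prob_no_true_reverse_take_le`). The outputs of the two halves differ in length by more than a
multiple of `ℓ` (`prob_length_sub_le`). Too little of the guard-band survives (`prob_guardWord_le`).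
The length deviation dictates the rate: the words have length of order `2^n`, which gives `exp(-κ
ℓ²/2^n)` with `ℓ²/2^n` of order `2^((1-2ξ)n)`. This beats `2^(-N^(2/3))` for large `n` exactly
because `ξ < 1/6` means `1 - 2ξ > 2/3`. The steps are assembled in `splitMiddle_trim` and
`zFull_le`.

The second inequality is Arıkan's single step: above level `n₀` the two halves with their deletions
are independent and identically distributed, so `bhattacharyya_minus_le` and `bhattacharyya_plus`
apply. -/

namespace TDC

/-! ### Trimming, and recovering two trimmed words by cutting in the middle. -/

theorem all_false_of_not_mem {l : List Bool} (h : true ∉ l) : ∀ b ∈ l, b = false := by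
  intro b hb
  cases b
  · rfl
  · exact absurd hb h

theorem trim_eq_nil {l : List Bool} (h : true ∉ l) : trim l = [] := by
  have h' := all_false_of_not_mem h
  have : l.dropWhile (fun b => !b) = [] := by
    rw [List.dropWhile_eq_nil_iff]
    intro b hb
    simp [h' b hb]
  simp [trim, this]

theorem trim_append_left {u : List Bool} (hu : true ∉ u) (l : List Bool) :
    trim (u ++ l) = trim l := by
  have : (u ++ l).dropWhile (fun b => !b) = l.dropWhile (fun b => !b) := by
    induction u with
    | nil => rfl
    | cons b u ih =>
      simp only [List.mem_cons, not_or] at hu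
      have : b = false := by simpa using hu.1
      subst this
      simpa using ih hu.2
  simp only [trim, this]

theorem rdropWhile_append_false {u : List Bool} (hu : true ∉ u) (l : List Bool) :
    (l ++ u).rdropWhile (fun b => !b) = l.rdropWhile (fun b => !b) := by
  induction u using List.reverseRecOn with
  | nil => simp
  | append_singleton u b ih =>
    simp only [List.mem_append, List.mem_singleton, not_or] at hu
    have : b = false := by simpa using hu.2
    subst this
    rw [← List.append_assoc, List.rdropWhile_concat_pos _ _ _ (by simp), ih hu.1]

theorem trim_append_right {u : List Bool} (hu : true ∉ u) (l : List Bool) :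
    trim (l ++ u) = trim l := by
  by_cases hl : true ∈ l
  -- With a `1` in `l`, `dropWhile` stops inside `l` and leaves the zeros `u` to `rdropWhile`;
  -- without one, it would consume `u` as well.
  · have : (l ++ u).dropWhile (fun b => !b) = l.dropWhile (fun b => !b) ++ u := by
      rw [List.dropWhile_append]
      have : l.dropWhile (fun b => !b) ≠ [] := by
        rw [ne_eq, List.dropWhile_eq_nil_iff]
        intro h
        simpa using h true hl
      simp [this]
    simp only [trim, this, rdropWhile_append_false hu]
  · rw [trim_eq_nil hl, trim_eq_nil (by simp [hl, hu])]

theorem trim_take_of_drop {l : List Bool} {s : ℕ} (h : true ∉ l.drop s) :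
    trim (l.take s) = trim l := by
  conv_rhs => rw [← List.take_append_drop s l]
  rw [trim_append_right h]

theorem trim_drop_of_take {l : List Bool} {s : ℕ} (h : true ∉ l.take s) :
    trim (l.drop s) = trim l := by
  conv_rhs => rw [← List.take_append_drop s l]
  rw [trim_append_left h]

theorem true_notMem_takeWhile (l : List Bool) : true ∉ l.takeWhile (fun t => !t) := by
  intro h
  simpa using List.mem_takeWhile_imp h

theorem true_notMem_rtakeWhile (l : List Bool) : true ∉ l.rtakeWhile (fun t => !t) := by
  intro h
  simpa using List.mem_rtakeWhile_imp h

/-- Trimming the part of the trimmed word that originates from `b` gives the trimming of `b`. -/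
theorem trim_trimmedPart (a b c : List Bool) : trim (trimmedPart a b c) = trim b := by
  simp only [trimmedPart]
  set y := a ++ b ++ c with hy
  set lead := (y.takeWhile fun t => !t).length with hl
  set trail := (y.rtakeWhile fun t => !t).length with ht
  -- What trimming the whole word removes from `b` lies in the leading or trailing zero run of the
  -- whole word, so trimming `b` itself would remove it too.
  have hlead : true ∉ b.take (lead - a.length) := by
    intro h
    apply true_notMem_takeWhile y
    have : y.take lead = y.takeWhile (fun t => !t) :=
      (List.prefix_iff_eq_take.1 (List.takeWhile_prefix _)).symm
    rw [← this]
    simp only [y, List.append_assoc, List.take_append, List.mem_append]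
    exact Or.inr (Or.inl h)
  have htrail : true ∉ b.drop (y.length - trail - a.length) := by
    intro h
    apply true_notMem_rtakeWhile y
    have : y.drop (y.length - trail) = y.rtakeWhile (fun t => !t) :=
      (List.suffix_iff_eq_drop.1 (List.rtakeWhile_suffix _ _)).symm
    rw [← this]
    generalize y.length - trail = k at h
    simp only [y, List.append_assoc, List.drop_append, List.mem_append]
    exact Or.inr (Or.inl h)
  rw [trim_drop_of_take, trim_take_of_drop htrail]
  rw [List.take_take]
  intro h
  exact hlead (List.take_subset_take_left _ (min_le_left _ _) h)

theorem exists_first_true {l : List Bool} {a : ℕ} (h : true ∈ l.take a) :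
    ∃ u v, l = u ++ true :: v ∧ true ∉ u ∧ u.length < a := by
  induction l generalizing a with
  | nil => simp at h
  | cons b l ih =>
    cases a with
    | zero => simp at h
    | succ a =>
      cases b with
      | true => exact ⟨[], l, by simp⟩
      | false =>
        obtain ⟨u, v, rfl, hu, hlen⟩ := ih (a := a) (by simpa using h)
        exact ⟨false :: u, v, by simp, by simpa using hu, by simpa using hlen⟩

theorem exists_last_true {l : List Bool} {a : ℕ} (h : true ∈ l.reverse.take a) :
    ∃ u v, l = v ++ true :: u ∧ true ∉ u ∧ u.length < a := by
  obtain ⟨u, v, h1, h2, h3⟩ := exists_first_true h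
  refine ⟨u.reverse, v.reverse, ?_, by simpa using h2, by simpa using h3⟩
  have := congrArg List.reverse h1
  simpa using this

theorem trim_true_append_true (m : List Bool) :
    trim (true :: (m ++ [true])) = true :: (m ++ [true]) := by
  have : (true :: (m ++ [true])).dropWhile (fun b => !b) = true :: (m ++ [true]) := by simp
  rw [trim, this, ← List.cons_append, List.rdropWhile_concat_neg _ _ _ (by simp)]

/-- Cutting a trimmed word in the middle and trimming both halves. -/
def splitMiddle (y : List Bool) : List Bool × List Bool :=
  (trim (y.take (y.length / 2)), trim (y.drop (y.length / 2)))

/-- If the middle run of zeros is long enough, the two outer parts are found by cutting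
in the middle. -/
theorem splitMiddle_trim {y₁ z y₂ : List Bool} {a : ℕ} (hz : true ∉ z)
    (h₁ : true ∈ y₁.take a) (h₂ : true ∈ y₂.reverse.take a)
    (h₃ : y₁.length + a ≤ y₂.length + z.length) (h₄ : y₂.length + a ≤ y₁.length + z.length) :
    splitMiddle (trim (y₁ ++ z ++ y₂)) = (trim y₁, trim y₂) := by
  obtain ⟨p, u, rfl, hp, hpa⟩ := exists_first_true h₁
  obtain ⟨q, v, rfl, hq, hqa⟩ := exists_last_true h₂
  have e : p ++ true :: u ++ z ++ (v ++ true :: q)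
      = p ++ ((true :: (u ++ z ++ v ++ [true])) ++ q) := by simp
  rw [e, trim_append_left hp, trim_append_right hq, trim_true_append_true, trim_append_left hp]
  have e2 : v ++ true :: q = (v ++ [true]) ++ q := by simp
  rw [e2, trim_append_right hq]
  have e3 : true :: (u ++ z ++ v ++ [true]) = (true :: u) ++ z ++ (v ++ [true]) := by simp
  rw [e3]
  set A := true :: u with hA
  set B := v ++ [true] with hB
  have hA1 : A.length = u.length + 1 := by simp [A]
  have hB1 : B.length = v.length + 1 := by simp [B]
  have hlen : (A ++ z ++ B).length = A.length + z.length + B.length := by simp; omega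
  simp only [List.length_append, List.length_cons] at h₃ h₄
  unfold splitMiddle
  set k := (A ++ z ++ B).length / 2 with hk
  -- Trimming removes fewer than `a` symbols from each outer end, so the slack `a` in `h₃` and `h₄`
  -- keeps the midpoint inside `z`.
  have hk1 : A.length ≤ k := by omega
  have hk2 : k ≤ A.length + z.length := by omega
  rw [List.append_assoc, List.take_append, List.drop_append, List.take_of_length_le hk1,
    List.drop_eq_nil_of_le hk1, List.take_append, List.drop_append]
  have e4 : k - A.length - z.length = 0 := by omega
  rw [e4]
  simp only [List.take_zero, List.append_nil, List.drop_zero, List.nil_append]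
  rw [trim_append_right (fun h => hz (List.mem_of_mem_take h)),
    trim_append_left (fun h => hz (List.mem_of_mem_drop h))]

theorem survivors_append {w₁ w₂ d₁ d₂ : List Bool} (h : w₁.length = d₁.length) :
    survivors (w₁ ++ w₂) (d₁ ++ d₂) = survivors w₁ d₁ ++ survivors w₂ d₂ := by
  simp [survivors, List.zip_append h]

theorem survivors_cons (b c : Bool) (w d : List Bool) :
    survivors (b :: w) (c :: d) = (if c then [] else [b]) ++ survivors w d := by
  cases c <;> simp [survivors]

theorem survivors_subset (w d : List Bool) : survivors w d ⊆ w := by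
  intro b hb
  simp only [survivors, List.mem_map, List.mem_filter] at hb
  obtain ⟨⟨x, y⟩, ⟨h, -⟩, rfl⟩ := hb
  exact (List.of_mem_zip h).1

theorem length_survivors_le (w d : List Bool) : (survivors w d).length ≤ w.length := by
  simp only [survivors, List.length_map]
  exact (List.length_filter_le _ _).trans (by simp)

end TDC

/-! ### Probabilities and Bhattacharyya parameters on finite sample spaces. -/

namespace TDC

/-- The product weight of two independent copies of `p` and one copy of `r`. -/
def tripleWeight {Ω Γ : Type*} (p : Ω → ℝ) (r : Γ → ℝ) (ω : Ω × Γ × Ω) : ℝ :=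
  p ω.1 * r ω.2.1 * p ω.2.2

theorem tripleWeight_nonneg {Ω Γ : Type*} {p : Ω → ℝ} {r : Γ → ℝ} (hp : ∀ ω, 0 ≤ p ω)
    (hr : ∀ γ, 0 ≤ r γ) (ω : Ω × Γ × Ω) : 0 ≤ tripleWeight p r ω :=
  mul_nonneg (mul_nonneg (hp _) (hr _)) (hp _)

section Probability

variable {Ω Ω' β β' Γ : Type*} [Fintype Ω] [Fintype Ω'] [Fintype Γ]

theorem prob_nonneg {p : Ω → ℝ} (hp : ∀ ω, 0 ≤ p ω) (E : Ω → Prop) : 0 ≤ prob p E := by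
  classical
  exact Finset.sum_nonneg fun ω _ => by split_ifs <;> simp [hp]

theorem prob_congr {p : Ω → ℝ} {E F : Ω → Prop} (h : ∀ ω, E ω ↔ F ω) : prob p E = prob p F := by
  rw [funext fun ω => propext (h ω)]

theorem prob_mono {p : Ω → ℝ} (hp : ∀ ω, 0 ≤ p ω) {E F : Ω → Prop} (h : ∀ ω, E ω → F ω) :
    prob p E ≤ prob p F := by
  classical
  refine Finset.sum_le_sum fun ω _ => ?_
  by_cases hE : E ω
  · simp [hE, h ω hE]
  · by_cases hF : F ω <;> simp [hE, hF, hp]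

theorem prob_or_le {p : Ω → ℝ} (hp : ∀ ω, 0 ≤ p ω) (E F : Ω → Prop) :
    prob p (fun ω => E ω ∨ F ω) ≤ prob p E + prob p F := by
  classical
  unfold prob
  rw [← Finset.sum_add_distrib]
  refine Finset.sum_le_sum fun ω _ => ?_
  by_cases hE : E ω <;> by_cases hF : F ω <;> simp [hE, hF, hp]

theorem prob_le_sum_mul {p : Ω → ℝ} (hp : ∀ ω, 0 ≤ p ω) {E : Ω → Prop} {f : Ω → ℝ}
    (hf : ∀ ω, 0 ≤ f ω) (h : ∀ ω, E ω → 1 ≤ f ω) : prob p E ≤ ∑ ω, p ω * f ω := by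
  classical
  refine Finset.sum_le_sum fun ω _ => ?_
  split_ifs with hE
  · exact le_mul_of_one_le_right (hp ω) (h ω hE)
  · exact mul_nonneg (hp ω) (hf ω)

theorem prob_le_one {p : Ω → ℝ} (hp : ∀ ω, 0 ≤ p ω) (hs : ∑ ω, p ω = 1) (E : Ω → Prop) :
    prob p E ≤ 1 := by
  have := prob_le_sum_mul hp (E := E) (f := fun _ => 1) (by simp) (by simp)
  simpa [hs] using this

theorem prob_equiv (e : Ω' ≃ Ω) (p : Ω → ℝ) (E : Ω → Prop) :
    prob p E = prob (fun ω => p (e ω)) (fun ω => E (e ω)) := by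
  classical
  exact (Equiv.sum_comp e (fun ω => if E ω then p ω else 0)).symm

open Classical in
theorem sum_prob_fiber (p : Ω → ℝ) (E : Ω → Prop) (B : Ω → β) (T : Finset β) :
    ∑ b ∈ T, prob p (fun ω => E ω ∧ B ω = b) = prob p (fun ω => E ω ∧ B ω ∈ T) := by
  unfold prob
  rw [Finset.sum_comm]
  refine Finset.sum_congr rfl fun ω _ => ?_
  by_cases hE : E ω <;> simp [hE]

open Classical in
-- Values outside the range of `B` contribute zero, so parameters with different observations can be
-- compared as sums over a common index set.
theorem bhattacharyya_eq_sum (p : Ω → ℝ) (A : Ω → Bool) (B : Ω → β) {T : Finset β}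
    (hT : ∀ ω, B ω ∈ T) :
    bhattacharyya p A B = 2 * ∑ b ∈ T,
      √(prob p (fun ω => A ω = false ∧ B ω = b) * prob p (fun ω => A ω = true ∧ B ω = b)) := by
  unfold bhattacharyya
  congr 1
  apply Finset.sum_subset
  · intro b hb
    obtain ⟨ω, -, rfl⟩ := Finset.mem_image.1 hb
    exact hT ω
  · intro b _ hb
    have : prob p (fun ω => A ω = false ∧ B ω = b) = 0 := by
      refine Finset.sum_eq_zero fun ω _ => ?_
      have : B ω ≠ b := fun h => hb (Finset.mem_image.2 ⟨ω, Finset.mem_univ _, h⟩)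
      simp [this]
    simp [this]

theorem bhattacharyya_nonneg (p : Ω → ℝ) (A : Ω → Bool) (B : Ω → β) :
    0 ≤ bhattacharyya p A B := by
  unfold bhattacharyya
  positivity

theorem bhattacharyya_equiv (e : Ω' ≃ Ω) (p : Ω → ℝ) (A : Ω → Bool) (B : Ω → β) :
    bhattacharyya p A B =
      bhattacharyya (fun ω => p (e ω)) (fun ω => A (e ω)) (fun ω => B (e ω)) := by
  classical
  rw [bhattacharyya_eq_sum (fun ω => p (e ω)) _ (fun ω => B (e ω)) (T := Finset.univ.image B)
    (fun ω => by simp)]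
  unfold bhattacharyya
  simp only [prob_equiv e p]

/-- The data processing inequality. -/
theorem bhattacharyya_le_of_factorsThrough {p : Ω → ℝ} (hp : ∀ ω, 0 ≤ p ω) (A : Ω → Bool)
    {B : Ω → β} {B' : Ω → β'} (h : B'.FactorsThrough B) :
    bhattacharyya p A B ≤ bhattacharyya p A B' := by
  classical
  rcases isEmpty_or_nonempty Ω with hΩ | ⟨⟨ω₀⟩⟩
  · simp [bhattacharyya, Finset.univ_eq_empty]
  have : Nonempty β' := ⟨B' ω₀⟩
  obtain ⟨φ, rfl⟩ := (Function.factorsThrough_iff B').1 h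
  unfold bhattacharyya
  refine mul_le_mul_of_nonneg_left ?_ zero_le_two
  -- Grouping the values of `B` by their image under `φ` reduces the claim to Cauchy–Schwarz on each
  -- fibre.
  rw [← Finset.sum_fiberwise_of_maps_to (s := Finset.univ.image B)
    (t := Finset.univ.image (φ ∘ B)) (g := φ)
    (by
      intro b hb
      obtain ⟨ω, -, rfl⟩ := Finset.mem_image.1 hb
      exact Finset.mem_image.2 ⟨ω, Finset.mem_univ _, rfl⟩)]
  refine Finset.sum_le_sum fun c _ => ?_
  have key : ∀ a : Bool, ∑ b ∈ (Finset.univ.image B).filter (fun b => φ b = c),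
      prob p (fun ω => A ω = a ∧ B ω = b) = prob p (fun ω => A ω = a ∧ (φ ∘ B) ω = c) := by
    intro a
    rw [sum_prob_fiber p (fun ω => A ω = a) B]
    exact prob_congr fun ω => by simp
  rw [← key false, ← key true, Real.sqrt_mul (Finset.sum_nonneg fun b _ => prob_nonneg hp _)]
  refine le_trans (le_of_eq ?_) (Real.sum_sqrt_mul_sqrt_le _ (fun b => prob_nonneg hp _)
    (fun b => prob_nonneg hp _))
  exact Finset.sum_congr rfl fun b _ => Real.sqrt_mul (prob_nonneg hp _) _

theorem sqrt_add_le_sqrt_add_sqrt {x y : ℝ} (hx : 0 ≤ x) (hy : 0 ≤ y) : √(x + y) ≤ √x + √y := by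
  refine Real.sqrt_le_iff.2 ⟨by positivity, ?_⟩
  have := mul_nonneg (Real.sqrt_nonneg x) (Real.sqrt_nonneg y)
  nlinarith [Real.sq_sqrt hx, Real.sq_sqrt hy]

theorem sqrt_mul_add_le {x y e f : ℝ} (hx : 0 ≤ x) (hy : 0 ≤ y) (he : 0 ≤ e) (hf : 0 ≤ f) :
    √((x + e) * (y + f)) ≤ √(x * y) + √x * √f + √e * √y + √e * √f := by
  rw [Real.sqrt_mul (by positivity), Real.sqrt_mul hx]
  have h1 : √(x + e) ≤ √x + √e := sqrt_add_le_sqrt_add_sqrt hx he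
  have h2 : √(y + f) ≤ √y + √f := sqrt_add_le_sqrt_add_sqrt hy hf
  calc √(x + e) * √(y + f) ≤ (√x + √e) * (√y + √f) := by gcongr
    _ = _ := by ring

/-- Changing the observation on an event of small probability changes the Bhattacharyya
parameter little. -/
theorem bhattacharyya_le_add_of_eq_off {p : Ω → ℝ} (hp : ∀ ω, 0 ≤ p ω) (hs : ∑ ω, p ω = 1)
    (A : Ω → Bool) {B B' : Ω → β} {bad : Ω → Prop} (h : ∀ ω, ¬ bad ω → B' ω = B ω) :
    bhattacharyya p A B' ≤ bhattacharyya p A B + 6 * √(prob p bad) := by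
  classical
  set T : Finset β := Finset.univ.image B ∪ Finset.univ.image B' with hT
  rw [bhattacharyya_eq_sum p A B (T := T) (fun ω => by simp [T]),
    bhattacharyya_eq_sum p A B' (T := T) (fun ω => by simp [T])]
  -- The joint law of `A` and `B'` is at most that of `A` and `B` plus a part `e` carried by the bad
  -- event. Expanding the square root leaves three cross terms, each at most `√(prob p bad)` by
  -- Cauchy–Schwarz; with the factor 2 in the definition this gives the 6.
  set x : Bool → β → ℝ := fun a b => prob p (fun ω => A ω = a ∧ B ω = b) with hx
  set e : Bool → β → ℝ := fun a b => prob p (fun ω => (bad ω ∧ A ω = a) ∧ B' ω = b) with he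
  have hx0 : ∀ a b, 0 ≤ x a b := fun a b => prob_nonneg hp _
  have he0 : ∀ a b, 0 ≤ e a b := fun a b => prob_nonneg hp _
  have hle : ∀ a b, prob p (fun ω => A ω = a ∧ B' ω = b) ≤ x a b + e a b := by
    intro a b
    refine le_trans (prob_mono hp ?_) (prob_or_le hp _ _)
    rintro ω ⟨h1, h2⟩
    by_cases hb : bad ω
    · exact Or.inr ⟨⟨hb, h1⟩, h2⟩
    · exact Or.inl ⟨h1, by rw [← h ω hb, h2]⟩
  have hxs : ∀ a, ∑ b ∈ T, x a b ≤ 1 := by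
    intro a
    rw [sum_prob_fiber p (fun ω => A ω = a) B]
    exact prob_le_one hp hs _
  have hes : ∀ a, ∑ b ∈ T, e a b ≤ prob p bad := by
    intro a
    rw [sum_prob_fiber p (fun ω => bad ω ∧ A ω = a) B']
    exact prob_mono hp fun ω h => h.1.1
  have hb1 := prob_le_one hp hs bad
  have hb0 := prob_nonneg hp bad
  have c1 : ∑ b ∈ T, √(x false b) * √(e true b) ≤ √(prob p bad) := by
    refine (Real.sum_sqrt_mul_sqrt_le _ (hx0 _) (he0 _)).trans ?_
    calc _ ≤ √1 * √(prob p bad) := by gcongr; exacts [hxs _, hes _]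
      _ = _ := by simp
  have c2 : ∑ b ∈ T, √(e false b) * √(x true b) ≤ √(prob p bad) := by
    refine (Real.sum_sqrt_mul_sqrt_le _ (he0 _) (hx0 _)).trans ?_
    calc _ ≤ √(prob p bad) * √1 := by gcongr; exacts [hes _, hxs _]
      _ = _ := by simp
  have c3 : ∑ b ∈ T, √(e false b) * √(e true b) ≤ √(prob p bad) := by
    refine (Real.sum_sqrt_mul_sqrt_le _ (he0 _) (he0 _)).trans ?_
    calc _ ≤ √(prob p bad) * √1 := by gcongr; exacts [hes _, (hes _).trans hb1]
      _ = _ := by simp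
  have : ∑ b ∈ T, √(prob p (fun ω => A ω = false ∧ B' ω = b) *
        prob p (fun ω => A ω = true ∧ B' ω = b))
      ≤ ∑ b ∈ T, (√(x false b * x true b) + √(x false b) * √(e true b)
        + √(e false b) * √(x true b) + √(e false b) * √(e true b)) := by
    refine Finset.sum_le_sum fun b _ => ?_
    refine le_trans (Real.sqrt_le_sqrt ?_) (sqrt_mul_add_le (hx0 _ _) (hx0 _ _) (he0 _ _) (he0 _ _))
    exact mul_le_mul (hle _ _) (hle _ _) (prob_nonneg hp _) (add_nonneg (hx0 _ _) (he0 _ _))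
  simp only [Finset.sum_add_distrib] at this
  linarith

variable {p : Ω → ℝ} {r : Γ → ℝ}

theorem sum_tripleWeight_mul (p : Ω → ℝ) (r : Γ → ℝ) (f : Ω → ℝ) (g : Γ → ℝ) (h : Ω → ℝ) :
    ∑ ω : Ω × Γ × Ω, tripleWeight p r ω * (f ω.1 * g ω.2.1 * h ω.2.2)
      = (∑ ω, p ω * f ω) * (∑ γ, r γ * g γ) * ∑ ω, p ω * h ω := by
  rw [mul_assoc, Finset.sum_mul_sum, Finset.sum_mul_sum]
  simp only [Fintype.sum_prod_type, tripleWeight, Finset.mul_sum]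
  refine Finset.sum_congr rfl fun _ _ => Finset.sum_congr rfl fun _ _ =>
    Finset.sum_congr rfl fun _ _ => by ring

theorem sum_tripleWeight (hs : ∑ ω, p ω = 1) (hrs : ∑ γ, r γ = 1) :
    ∑ ω, tripleWeight p r ω = 1 := by
  have := sum_tripleWeight_mul p r (fun _ => 1) (fun _ => 1) (fun _ => 1)
  simpa [hs, hrs] using this

theorem prob_tripleWeight_and (hrs : ∑ γ, r γ = 1) (E F : Ω → Prop) :
    prob (tripleWeight p r) (fun ω => E ω.1 ∧ F ω.2.2) = prob p E * prob p F := by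
  classical
  have := sum_tripleWeight_mul p r (fun ω => if E ω then 1 else 0) (fun _ => 1)
    (fun ω => if F ω then 1 else 0)
  simp only [mul_one, hrs, mul_ite, mul_zero] at this
  unfold prob
  rw [← this]
  refine Finset.sum_congr rfl fun ω _ => ?_
  by_cases hE : E ω.1 <;> by_cases hF : F ω.2.2 <;> simp [hE, hF]

theorem prob_true (hs : ∑ ω, p ω = 1) : prob p (fun _ => True) = 1 := by
  simp [prob, hs]

theorem prob_tripleWeight_fst (hs : ∑ ω, p ω = 1) (hrs : ∑ γ, r γ = 1) (E : Ω → Prop) :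
    prob (tripleWeight p r) (fun ω => E ω.1) = prob p E := by
  have := prob_tripleWeight_and (p := p) hrs E (fun _ => True)
  simpa [prob_true hs] using this

theorem prob_tripleWeight_snd (hs : ∑ ω, p ω = 1) (hrs : ∑ γ, r γ = 1) (E : Ω → Prop) :
    prob (tripleWeight p r) (fun ω => E ω.2.2) = prob p E := by
  have := prob_tripleWeight_and (p := p) hrs (fun _ => True) E
  simpa [prob_true hs] using this

theorem prob_tripleWeight_mid (hs : ∑ ω, p ω = 1) (E : Γ → Prop) :
    prob (tripleWeight p r) (fun ω => E ω.2.1) = prob r E := by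
  classical
  have := sum_tripleWeight_mul p r (fun _ => 1) (fun γ => if E γ then 1 else 0) (fun _ => 1)
  simp only [mul_one, hs, mul_ite, mul_zero, one_mul] at this
  exact this

theorem bhattacharyya_tripleWeight_fst (hs : ∑ ω, p ω = 1) (hrs : ∑ γ, r γ = 1)
    (A : Ω → Bool) (B : Ω → β) :
    bhattacharyya (tripleWeight p r) (fun ω => A ω.1) (fun ω => B ω.1) = bhattacharyya p A B := by
  classical
  rw [bhattacharyya_eq_sum _ _ (fun ω : Ω × Γ × Ω => B ω.1) (T := Finset.univ.image B)
    (fun ω => by simp)]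
  unfold bhattacharyya
  congr 1
  refine Finset.sum_congr rfl fun b _ => ?_
  rw [prob_tripleWeight_fst hs hrs (fun ω => A ω = false ∧ B ω = b),
    prob_tripleWeight_fst hs hrs (fun ω => A ω = true ∧ B ω = b)]

/-- The plus transform squares the Bhattacharyya parameter. -/
theorem bhattacharyya_plus (hp : ∀ ω, 0 ≤ p ω) (hrs : ∑ γ, r γ = 1)
    (A : Ω → Bool) (B : Ω → β) :
    bhattacharyya (tripleWeight p r) (fun ω => A ω.2.2)
      (fun ω => (xor (A ω.1) (A ω.2.2), B ω.1, B ω.2.2)) = bhattacharyya p A B ^ 2 := by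
  classical
  set T := Finset.univ.image B with hT
  rw [bhattacharyya_eq_sum _ _ (fun ω : Ω × Γ × Ω => (xor (A ω.1) (A ω.2.2), B ω.1, B ω.2.2))
    (T := Finset.univ ×ˢ T ×ˢ T) (fun ω => by
      simp only [Finset.mem_product, Finset.mem_univ, true_and, T]
      exact ⟨Finset.mem_image_of_mem _ (Finset.mem_univ _),
        Finset.mem_image_of_mem _ (Finset.mem_univ _)⟩)]
  set x : Bool → β → ℝ := fun a b => prob p (fun ω => A ω = a ∧ B ω = b) with hx
  have hx0 : ∀ a b, 0 ≤ x a b := fun a b => prob_nonneg hp _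
  have key : ∀ (a u : Bool) (b b' : β), prob (tripleWeight p r)
      (fun ω => A ω.2.2 = a ∧ (xor (A ω.1) (A ω.2.2), B ω.1, B ω.2.2) = (u, b, b'))
      = x (xor u a) b * x a b' := by
    intro a u b b'
    rw [← prob_tripleWeight_and hrs]
    refine prob_congr fun ω => ?_
    simp only [Prod.mk.injEq]
    constructor
    · rintro ⟨h1, h2, h3, h4⟩
      refine ⟨⟨?_, h3⟩, h1, h4⟩
      rw [← h2, h1]; simp
    · rintro ⟨⟨h1, h2⟩, h3, h4⟩
      refine ⟨h3, ?_, h2, h4⟩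
      rw [h1, h3]; simp
  -- The same four factors appear for both values of `u`, only permuted, so the sum over `u` is a
  -- factor 2, the one needed to complete the square of `2 * ∑`.
  have term : ∀ (u : Bool) (b b' : β), √(x (xor u false) b * x false b' *
      (x (xor u true) b * x true b')) =
      √(x false b * x true b) * √(x false b' * x true b') := by
    intro u b b'
    rw [← Real.sqrt_mul (mul_nonneg (hx0 _ _) (hx0 _ _))]
    congr 1
    cases u <;> simp <;> ring
  simp only [Finset.sum_product, key, term, Fintype.sum_bool]
  change _ = (2 * ∑ b ∈ T, √(x false b * x true b)) ^ 2
  rw [mul_pow, sq (∑ b ∈ T, √(x false b * x true b)), Finset.sum_mul_sum]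
  ring

/-- The radicand expands to `(a² + b²)cd + (c² + d²)ab`, which is dominated by the square of the
right side even without its mixed term. -/
theorem sqrt_four_le {a b c d : ℝ} (ha : 0 ≤ a) (hb : 0 ≤ b) (hc : 0 ≤ c) (hd : 0 ≤ d) :
    √((a * c + b * d) * (a * d + b * c)) ≤ (a + b) * √(c * d) + (c + d) * √(a * b) := by
  have h1 := Real.mul_self_sqrt (mul_nonneg hc hd)
  have h2 := Real.mul_self_sqrt (mul_nonneg ha hb)
  have h3 := Real.sqrt_nonneg (c * d)
  have h4 := Real.sqrt_nonneg (a * b)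
  refine Real.sqrt_le_iff.2 ⟨by positivity, ?_⟩
  have h5 : 0 ≤ (a + b) * (c + d) * (√(c * d) * √(a * b)) := by positivity
  have h6 : 0 ≤ a * b * (c * d) := by positivity
  have h7 : ((a + b) * √(c * d) + (c + d) * √(a * b)) ^ 2 = (a + b) ^ 2 * (√(c * d) * √(c * d))
      + (c + d) ^ 2 * (√(a * b) * √(a * b)) + 2 * ((a + b) * (c + d) * (√(c * d) * √(a * b))) := by
    ring
  rw [h7, h1, h2]
  linarith

/-- The minus transform at most doubles the Bhattacharyya parameter. -/
theorem bhattacharyya_minus_le (hp : ∀ ω, 0 ≤ p ω) (hr : ∀ γ, 0 ≤ r γ)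
    (hs : ∑ ω, p ω = 1) (hrs : ∑ γ, r γ = 1)
    (A : Ω → Bool) (B : Ω → β) :
    bhattacharyya (tripleWeight p r) (fun ω => xor (A ω.1) (A ω.2.2))
      (fun ω => (B ω.1, B ω.2.2)) ≤ 2 * bhattacharyya p A B := by
  classical
  set T := Finset.univ.image B with hT
  rw [bhattacharyya_eq_sum _ _ (fun ω : Ω × Γ × Ω => (B ω.1, B ω.2.2))
    (T := T ×ˢ T) (fun ω => by simp [T])]
  set x : Bool → β → ℝ := fun a b => prob p (fun ω => A ω = a ∧ B ω = b) with hx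
  have hx0 : ∀ a b, 0 ≤ x a b := fun a b => prob_nonneg hp _
  have hsum : ∑ b ∈ T, (x false b + x true b) = 1 := by
    rw [Finset.sum_add_distrib, sum_prob_fiber p (fun ω => A ω = false) B,
      sum_prob_fiber p (fun ω => A ω = true) B, ← hs]
    unfold prob
    rw [← Finset.sum_add_distrib]
    refine Finset.sum_congr rfl fun ω _ => ?_
    have hmem : B ω ∈ T := Finset.mem_image_of_mem _ (Finset.mem_univ _)
    cases h : A ω <;> simp [hmem, h]
  have key : ∀ (a : Bool) (b b' : β), prob (tripleWeight p r)
      (fun ω => xor (A ω.1) (A ω.2.2) = a ∧ (B ω.1, B ω.2.2) = (b, b'))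
      ≤ x false b * x a b' + x true b * x (!a) b' := by
    intro a b b'
    rw [← prob_tripleWeight_and hrs, ← prob_tripleWeight_and hrs]
    refine le_trans (prob_mono (tripleWeight_nonneg hp hr) ?_)
      (prob_or_le (tripleWeight_nonneg hp hr) _ _)
    intro ω
    simp only [Prod.mk.injEq]
    rintro ⟨h1, h2, h3⟩
    cases h : A ω.1 <;> rw [h] at h1
    · exact Or.inl ⟨⟨rfl, h2⟩, by simpa using h1, h3⟩
    · exact Or.inr ⟨⟨rfl, h2⟩, by simpa using congrArg not h1, h3⟩
  have term : ∀ b b' : β, √(prob (tripleWeight p r)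
        (fun ω => xor (A ω.1) (A ω.2.2) = false ∧ (B ω.1, B ω.2.2) = (b, b')) *
      prob (tripleWeight p r)
        (fun ω => xor (A ω.1) (A ω.2.2) = true ∧ (B ω.1, B ω.2.2) = (b, b')))
      ≤ (x false b + x true b) * √(x false b' * x true b')
        + (x false b' + x true b') * √(x false b * x true b) := by
    intro b b'
    refine le_trans (Real.sqrt_le_sqrt ?_) (sqrt_four_le (hx0 _ _) (hx0 _ _) (hx0 _ _) (hx0 _ _))
    exact mul_le_mul (key false b b') (key true b b')
      (prob_nonneg (tripleWeight_nonneg hp hr) _)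
      (add_nonneg (mul_nonneg (hx0 _ _) (hx0 _ _)) (mul_nonneg (hx0 _ _) (hx0 _ _)))
  -- In the double sum of `term`, one of the two factors of each product sums to the total mass 1;
  -- the two summands then contribute equally, whence the factor 2.
  change _ ≤ 2 * (2 * ∑ b ∈ T, √(x false b * x true b))
  refine mul_le_mul_of_nonneg_left ?_ zero_le_two
  rw [Finset.sum_product]
  refine (Finset.sum_le_sum fun b _ => Finset.sum_le_sum fun b' _ => term b b').trans ?_
  simp only [Finset.sum_add_distrib, ← Finset.mul_sum, ← Finset.sum_mul] at hsum ⊢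
  rw [hsum]
  linarith

end Probability

end TDC

/-! ### Sums over binary words and generating functions of the deletion channel. -/

namespace TDC

/-- The sum of a function over all binary words of length `L`. -/
def wordSum (L : ℕ) (f : List Bool → ℝ) : ℝ :=
  ∑ x : Fin L → Bool, f (List.ofFn x)

theorem wordSum_zero (f : List Bool → ℝ) : wordSum 0 f = f [] := by
  simp [wordSum]

theorem wordSum_add_right (a b : ℕ) (f : List Bool → ℝ) :
    wordSum (a + b) f = wordSum a fun u => wordSum b fun v => f (u ++ v) := by
  unfold wordSum
  rw [← Equiv.sum_comp (Fin.appendEquiv a b), Fintype.sum_prod_type]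
  simp [Fin.appendEquiv, List.ofFn_fin_append]

theorem wordSum_one (f : List Bool → ℝ) : wordSum 1 f = f [true] + f [false] := by
  unfold wordSum
  rw [← Equiv.sum_comp (Equiv.funUnique (Fin 1) Bool).symm]
  simp

theorem wordSum_succ (L : ℕ) (f : List Bool → ℝ) :
    wordSum (L + 1) f
      = wordSum L (fun w => f (true :: w)) + wordSum L (fun w => f (false :: w)) := by
  rw [add_comm L 1, wordSum_add_right, wordSum_one]
  simp

theorem wordSum_nonneg {L : ℕ} {f : List Bool → ℝ} (h : ∀ w, 0 ≤ f w) : 0 ≤ wordSum L f :=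
  Finset.sum_nonneg fun _ _ => h _

theorem wordSum_mul_left (L : ℕ) (c : ℝ) (f : List Bool → ℝ) :
    wordSum L (fun w => c * f w) = c * wordSum L f :=
  Finset.mul_sum _ _ _ |>.symm

theorem wordSum_sum {ι : Type*} (s : Finset ι) (L : ℕ) (f : ι → List Bool → ℝ) :
    wordSum L (fun w => ∑ i ∈ s, f i w) = ∑ i ∈ s, wordSum L (f i) :=
  Finset.sum_comm

/-- The probability of a deletion pattern. -/
def delWeight (δ : ℝ) (d : List Bool) : ℝ :=
  (d.map fun b => if b then δ else 1 - δ).prod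

theorem delWeight_append (δ : ℝ) (d e : List Bool) :
    delWeight δ (d ++ e) = delWeight δ d * delWeight δ e := by
  simp [delWeight]

theorem delWeight_ofFn (δ : ℝ) {L : ℕ} (d : Fin L → Bool) :
    delWeight δ (List.ofFn d) = ∏ k, if d k then δ else 1 - δ := by
  simp [delWeight, List.map_ofFn, List.prod_ofFn]

theorem delWeight_cons_true (δ : ℝ) (d : List Bool) :
    delWeight δ (true :: d) = δ * delWeight δ d := by
  simp [delWeight]

theorem delWeight_cons_false (δ : ℝ) (d : List Bool) :
    delWeight δ (false :: d) = (1 - δ) * delWeight δ d := by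
  simp [delWeight]

theorem delWeight_nonneg {δ : ℝ} (h0 : 0 ≤ δ) (h1 : δ ≤ 1) (d : List Bool) :
    0 ≤ delWeight δ d := by
  induction d with
  | nil => simp [delWeight]
  | cons b d ih =>
    cases b
    · rw [delWeight_cons_false]; exact mul_nonneg (by linarith) ih
    · rw [delWeight_cons_true]; exact mul_nonneg h0 ih

theorem wordSum_delWeight (δ : ℝ) (L : ℕ) : wordSum L (delWeight δ) = 1 := by
  induction L with
  | zero => simp [wordSum_zero, delWeight]
  | succ L ih =>
    rw [wordSum_succ]
    simp only [delWeight_cons_true, delWeight_cons_false, wordSum_mul_left, ih]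
    ring

/-- Each symbol independently contributes 1 if deleted and `c` if kept. This exact moment generating
function feeds the Chernoff bounds for output lengths. -/
theorem wordSum_delWeight_mul_pow_length (δ c : ℝ) (w : List Bool) :
    wordSum w.length (fun d => delWeight δ d * c ^ (survivors w d).length)
      = (δ + (1 - δ) * c) ^ w.length := by
  induction w with
  | nil => simp [wordSum_zero, delWeight, survivors]
  | cons b w ih =>
    rw [List.length_cons, wordSum_succ, pow_succ, ← ih]
    have h1 : ∀ d, delWeight δ (true :: d) * c ^ (survivors (b :: w) (true :: d)).length
        = δ * (delWeight δ d * c ^ (survivors w d).length) := by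
      intro d
      simp [delWeight_cons_true, survivors_cons, mul_assoc]
    have h2 : ∀ d, delWeight δ (false :: d) * c ^ (survivors (b :: w) (false :: d)).length
        = ((1 - δ) * c) * (delWeight δ d * c ^ (survivors w d).length) := by
      intro d
      simp only [delWeight_cons_false, survivors_cons, List.length_append]
      simp [pow_add]
      ring
    simp only [h1, h2, wordSum_mul_left]
    ring

theorem wordSum_delWeight_no_true (δ : ℝ) (w : List Bool) :
    wordSum w.length (fun d => delWeight δ d * if true ∈ survivors w d then 0 else 1)
      = δ ^ w.count true := by
  induction w with
  | nil => simp [wordSum_zero, delWeight, survivors]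
  | cons b w ih =>
    have h1 : ∀ d, (delWeight δ (true :: d) *
        if true ∈ survivors (b :: w) (true :: d) then 0 else 1)
        = δ * (delWeight δ d * if true ∈ survivors w d then 0 else 1) := by
      intro d
      simp [delWeight_cons_true, survivors_cons]
    rw [List.length_cons, wordSum_succ]
    simp only [h1, wordSum_mul_left, ih]
    cases b with
    | true =>
      have h2 : ∀ d, (delWeight δ (false :: d) *
          if true ∈ survivors (true :: w) (false :: d) then 0 else 1) = 0 * (0 : ℝ) := by
        intro d
        simp [survivors_cons]
      simp only [h2, wordSum_mul_left, List.count_cons_self, pow_succ]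
      ring
    | false =>
      have h2 : ∀ d, (delWeight δ (false :: d) *
          if true ∈ survivors (false :: w) (false :: d) then 0 else 1)
          = (1 - δ) * (delWeight δ d * if true ∈ survivors w d then 0 else 1) := by
        intro d
        simp [delWeight_cons_false, survivors_cons]
      simp only [h2, wordSum_mul_left, ih]
      rw [List.count_cons_of_ne (by simp)]
      ring

end TDC

/-! ### Hidden-Markov sources: marginals, and exponential decay of the chance that all ones are
deleted. -/

namespace HiddenMarkov

open TDC

variable {S : Type*} [Fintype S] (H : HiddenMarkov S)

theorem wordProbFrom_nonneg (w : List Bool) (s : S) : 0 ≤ H.wordProbFrom w s := by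
  induction w generalizing s with
  | nil => simp [wordProbFrom]
  | cons b w ih => exact Finset.sum_nonneg fun s' _ => mul_nonneg (H.kernel_nonneg _ _ _) (ih s')

theorem wordProb_nonneg (w : List Bool) : 0 ≤ H.wordProb w :=
  Finset.sum_nonneg fun s _ => mul_nonneg (H.init_nonneg s) (H.wordProbFrom_nonneg w s)

theorem kernel_sum' (s : S) :
    ∑ s', (H.kernel s s' true + H.kernel s s' false) = 1 := by
  simpa using H.kernel_sum s

theorem wordSum_wordProbFrom (L : ℕ) (s : S) : wordSum L (fun w => H.wordProbFrom w s) = 1 := by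
  induction L generalizing s with
  | zero => simp [wordSum_zero, wordProbFrom]
  | succ L ih =>
    rw [wordSum_succ]
    simp only [wordProbFrom, wordSum_sum, wordSum_mul_left, ih, mul_one]
    rw [← Finset.sum_add_distrib, H.kernel_sum']

theorem wordSum_wordProbFrom_append (L : ℕ) (u : List Bool) (s : S) :
    wordSum L (fun v => H.wordProbFrom (u ++ v) s) = H.wordProbFrom u s := by
  induction u generalizing s with
  | nil => simpa [wordProbFrom] using H.wordSum_wordProbFrom L s
  | cons b u ih =>
    simp only [List.cons_append, wordProbFrom, wordSum_sum, wordSum_mul_left, ih]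

theorem wordSum_wordProb_append_right (L : ℕ) (u : List Bool) :
    wordSum L (fun v => H.wordProb (u ++ v)) = H.wordProb u := by
  simp only [wordProb, wordSum_sum, wordSum_mul_left, wordSum_wordProbFrom_append]

theorem wordProb_nil : H.wordProb [] = 1 := by
  simp [wordProb, wordProbFrom, H.init_sum]

theorem wordSum_wordProb (L : ℕ) : wordSum L H.wordProb = 1 := by
  simpa [H.wordProb_nil] using H.wordSum_wordProb_append_right L []

variable {H}

/-- Stationarity: discarding the first emitted bit does not change the law of the rest. It is what
gives the second half of a block the same law as a shorter block. -/
theorem wordProb_cons_add (hst : ∀ s', ∑ s, H.init s * H.trans s s' = H.init s') (w : List Bool) :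
    H.wordProb (true :: w) + H.wordProb (false :: w) = H.wordProb w := by
  simp only [wordProb, wordProbFrom]
  rw [← Finset.sum_add_distrib]
  have : ∀ s, (H.init s * ∑ s', H.kernel s s' true * H.wordProbFrom w s'
      + H.init s * ∑ s', H.kernel s s' false * H.wordProbFrom w s')
      = ∑ s', H.init s * H.trans s s' * H.wordProbFrom w s' := by
    intro s
    rw [← mul_add, ← Finset.sum_add_distrib, Finset.mul_sum]
    refine Finset.sum_congr rfl fun s' _ => ?_
    simp [trans]
    ring
  simp only [this]
  rw [Finset.sum_comm]
  simp only [← Finset.sum_mul, hst]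

theorem wordSum_wordProb_append_left (hst : ∀ s', ∑ s, H.init s * H.trans s s' = H.init s')
    (L : ℕ) (v : List Bool) :
    wordSum L (fun u => H.wordProb (u ++ v)) = H.wordProb v := by
  induction L with
  | zero => simp [wordSum_zero]
  | succ L ih =>
    rw [wordSum_succ]
    have : ∀ u, H.wordProb (false :: u ++ v) =
        H.wordProb (u ++ v) - H.wordProb (true :: u ++ v) := by
      intro u
      rw [← wordProb_cons_add hst (u ++ v)]
      simp
    simp only [this]
    rw [wordSum, wordSum, Finset.sum_sub_distrib, add_sub_cancel]
    exact ih

variable (H)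

/-- `E[δ ^ (X₁ + ⋯ + X_L) | S₀ = s]`. -/
noncomputable def onesGen (δ : ℝ) (L : ℕ) (s : S) : ℝ :=
  wordSum L fun w => H.wordProbFrom w s * δ ^ w.count true

theorem onesGen_zero (δ : ℝ) (s : S) : H.onesGen δ 0 s = 1 := by
  simp [onesGen, wordSum_zero, wordProbFrom]

theorem onesGen_succ (δ : ℝ) (L : ℕ) (s : S) :
    H.onesGen δ (L + 1) s
      = ∑ s', (δ * H.kernel s s' true + H.kernel s s' false) * H.onesGen δ L s' := by
  unfold onesGen
  rw [wordSum_succ]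
  have h1 : ∀ w, H.wordProbFrom (true :: w) s * δ ^ (true :: w).count true
      = ∑ s', (δ * H.kernel s s' true) * (H.wordProbFrom w s' * δ ^ w.count true) := by
    intro w
    rw [wordProbFrom, Finset.sum_mul, List.count_cons_self, pow_succ]
    exact Finset.sum_congr rfl fun s' _ => by ring
  have h2 : ∀ w, H.wordProbFrom (false :: w) s * δ ^ (false :: w).count true
      = ∑ s', H.kernel s s' false * (H.wordProbFrom w s' * δ ^ w.count true) := by
    intro w
    rw [wordProbFrom, Finset.sum_mul, List.count_cons_of_ne (by simp)]
    exact Finset.sum_congr rfl fun s' _ => by ring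
  simp only [h1, h2, wordSum_sum, wordSum_mul_left]
  rw [← Finset.sum_add_distrib]
  exact Finset.sum_congr rfl fun s' _ => by ring

variable {δ : ℝ}

theorem onesGen_nonneg (h0 : 0 ≤ δ) (L : ℕ) (s : S) : 0 ≤ H.onesGen δ L s :=
  wordSum_nonneg fun w => mul_nonneg (H.wordProbFrom_nonneg w s) (pow_nonneg h0 _)

theorem tilted_nonneg (h0 : 0 ≤ δ) (s s' : S) :
    0 ≤ δ * H.kernel s s' true + H.kernel s s' false :=
  add_nonneg (mul_nonneg h0 (H.kernel_nonneg _ _ _)) (H.kernel_nonneg _ _ _)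

theorem sum_tilted_le_one (h1 : δ ≤ 1) (s : S) :
    ∑ s', (δ * H.kernel s s' true + H.kernel s s' false) ≤ 1 := by
  rw [← H.kernel_sum' s]
  exact Finset.sum_le_sum fun s' _ =>
    add_le_add_left (mul_le_of_le_one_left (H.kernel_nonneg _ _ _) h1) _

/-- The Markov property: given the state after `L` steps, the remaining `K` steps contribute a
factor at most `μ`, whatever that state is. -/
theorem onesGen_add_le (h0 : 0 ≤ δ) {K : ℕ} {μ : ℝ} (hμ : ∀ s, H.onesGen δ K s ≤ μ)
    (L : ℕ) (s : S) : H.onesGen δ (L + K) s ≤ H.onesGen δ L s * μ := by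
  induction L generalizing s with
  | zero => simpa [onesGen_zero] using hμ s
  | succ L ih =>
    rw [Nat.add_right_comm L 1 K, onesGen_succ, onesGen_succ, Finset.sum_mul]
    refine Finset.sum_le_sum fun s' _ => ?_
    rw [mul_assoc]
    exact mul_le_mul_of_nonneg_left (ih s') (H.tilted_nonneg h0 s s')

theorem onesGen_le_one (h0 : 0 ≤ δ) (h1 : δ ≤ 1) (L : ℕ) (s : S) : H.onesGen δ L s ≤ 1 := by
  induction L generalizing s with
  | zero => simp [onesGen_zero]
  | succ L ih =>
    rw [onesGen_succ]
    refine le_trans (Finset.sum_le_sum fun s' _ => ?_) (H.sum_tilted_le_one h1 s)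
    exact mul_le_of_le_one_right (H.tilted_nonneg h0 s s') (ih s')

theorem onesGen_antitone (h0 : 0 ≤ δ) (h1 : δ ≤ 1) (s : S) : Antitone fun L => H.onesGen δ L s :=
  antitone_nat_of_succ_le fun L => by
    simpa using H.onesGen_add_le h0 (K := 1) (μ := 1) (H.onesGen_le_one h0 h1 1) L s

theorem onesGen_mul_le (h0 : 0 ≤ δ) {K : ℕ} {μ : ℝ} (hμ0 : 0 ≤ μ) (hμ : ∀ s, H.onesGen δ K s ≤ μ)
    (m : ℕ) (s : S) : H.onesGen δ (m * K) s ≤ μ ^ m := by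
  induction m with
  | zero => simp [onesGen_zero]
  | succ m ih =>
    rw [Nat.succ_mul, pow_succ]
    exact (H.onesGen_add_le h0 hμ _ s).trans (mul_le_mul_of_nonneg_right ih hμ0)

variable {H}

open Classical in
-- The states from which the generating function never drops below 1 are closed under possible
-- transitions. If there were one, irreducibility would make every state such; taking length 1, no
-- state could emit a `1`, against non-degeneracy.
theorem exists_onesGen_lt_one (hH : H.IsRegular) (hnd : H.NonDegenerate)
    (h0 : 0 ≤ δ) (h1 : δ < 1) (s : S) : ∃ L, H.onesGen δ L s < 1 := by
  by_contra! hs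
  have closed : ∀ s, (∀ L, 1 ≤ H.onesGen δ L s) → ∀ s', 0 < H.trans s s' →
      ∀ L, 1 ≤ H.onesGen δ L s' := by
    intro s hs s' hss' L
    by_contra! hlt
    have h2 := hs (L + 1)
    rw [onesGen_succ] at h2
    -- For `δ = 0` a possible transition may have tilted weight zero, when it always emits a `1`.
    -- The strict loss must then be measured against the full kernel, whose mass is 1.
    rcases h0.eq_or_lt with rfl | hpos
    · have e := H.kernel_sum' s
      have h3 : ∑ t, (0 * H.kernel s t true + H.kernel s t false) * H.onesGen 0 L t
          < ∑ t, (H.kernel s t true + H.kernel s t false) := by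
        refine Finset.sum_lt_sum (fun t _ => ?_) ⟨s', Finset.mem_univ _, ?_⟩
        · have := H.onesGen_le_one le_rfl zero_le_one L t
          nlinarith [H.kernel_nonneg s t true, H.kernel_nonneg s t false]
        · have := H.onesGen_nonneg le_rfl L s'
          simp only [trans, Matrix.of_apply, Fintype.sum_bool] at hss'
          rcases (H.kernel_nonneg s s' true).eq_or_lt with h | h
          · nlinarith [H.kernel_nonneg s s' false]
          · nlinarith [H.kernel_nonneg s s' false]
      linarith
    · have h3 : ∑ t, (δ * H.kernel s t true + H.kernel s t false) * H.onesGen δ L t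
          < ∑ t, (δ * H.kernel s t true + H.kernel s t false) := by
        refine Finset.sum_lt_sum (fun t _ => ?_) ⟨s', Finset.mem_univ _, ?_⟩
        · exact mul_le_of_le_one_right (H.tilted_nonneg h0 s t) (H.onesGen_le_one h0 h1.le L t)
        · refine mul_lt_of_lt_one_right ?_ hlt
          simp only [trans, Matrix.of_apply, Fintype.sum_bool] at hss'
          rcases (H.kernel_nonneg s s' true).eq_or_lt with h | h
          · rw [← h] at hss' ⊢; linarith
          · have := mul_pos hpos h
            linarith [H.kernel_nonneg s s' false]
      linarith [H.sum_tilted_le_one h1.le s]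
  have nn : ∀ i j, 0 ≤ H.trans i j := by
    intro i j
    simp only [trans, Matrix.of_apply]
    exact Finset.sum_nonneg fun b _ => H.kernel_nonneg i j b
  have pow_closed : ∀ k t, 0 < (H.trans ^ k) s t → ∀ L, 1 ≤ H.onesGen δ L t := by
    intro k
    induction k with
    | zero =>
      intro t ht
      by_cases h : s = t
      · exact h ▸ hs
      · simp [h] at ht
    | succ k ih =>
      intro t ht
      rw [pow_succ, Matrix.mul_apply] at ht
      obtain ⟨j, -, hj⟩ := Finset.exists_lt_of_sum_lt (f := fun _ => (0 : ℝ)) (by simpa using ht)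
      have hk : 0 ≤ (H.trans ^ k) s j := Matrix.pow_apply_nonneg nn k s j
      have hpos : 0 < (H.trans ^ k) s j ∧ 0 < H.trans j t := by
        constructor
        · exact lt_of_le_of_ne hk (fun h => by simp [← h] at hj)
        · exact lt_of_le_of_ne (nn j t) (fun h => by simp [← h] at hj)
      exact closed j (ih j hpos.1) t hpos.2
  have all : ∀ t, 1 ≤ H.onesGen δ 1 t := by
    intro t
    obtain ⟨k, -, hk⟩ := (Matrix.isIrreducible_iff_exists_pow_pos nn).1 hH.irreducible s t
    exact pow_closed k t hk 1
  have : H.wordProb [true] ≤ 0 := by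
    unfold wordProb
    refine Finset.sum_nonpos fun t _ => mul_nonpos_of_nonneg_of_nonpos (H.init_nonneg t) ?_
    have h2 := all t
    rw [show (1 : ℕ) = 0 + 1 from rfl, onesGen_succ] at h2
    simp only [onesGen_zero, mul_one, wordProbFrom] at h2 ⊢
    have h3 := H.kernel_sum' t
    rw [Finset.sum_add_distrib] at h2 h3
    rw [← Finset.mul_sum] at h2
    nlinarith
  exact absurd hnd (not_lt.2 this)

theorem sum_init_onesGen (H : HiddenMarkov S) (δ : ℝ) (L : ℕ) :
    wordSum L (fun w => H.wordProb w * δ ^ w.count true) = ∑ s, H.init s * H.onesGen δ L s := by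
  simp only [wordProb, Finset.sum_mul, onesGen, mul_assoc, wordSum_sum, wordSum_mul_left]

/-- The probability that all ones among the first `L` bits are deleted decays exponentially. -/
theorem exists_ones_decay (hH : H.IsRegular) (hnd : H.NonDegenerate) (h0 : 0 ≤ δ) (h1 : δ < 1) :
    ∃ ρ : ℝ, 0 < ρ ∧ ρ < 1 ∧
      ∀ L, wordSum L (fun w => H.wordProb w * δ ^ w.count true) ≤ ρ ^ L := by
  choose K hK using exists_onesGen_lt_one hH hnd h0 h1
  obtain ⟨K₀, hK₀⟩ : ∃ K₀, ∀ s, K s ≤ K₀ := ⟨∑ s, K s, fun s =>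
    Finset.single_le_sum (fun _ _ => Nat.zero_le _) (Finset.mem_univ s)⟩
  set K₁ := K₀ + 1
  have hlt : ∀ s, H.onesGen δ K₁ s < 1 := fun s =>
    (H.onesGen_antitone h0 h1.le s ((hK₀ s).trans (Nat.le_succ _))).trans_lt (hK s)
  -- The final bound carries no constant in front, since later it is squared at every doubling of
  -- the length. Lengths below `K₁` therefore need a strict inequality of their own, and
  -- monotonicity reduces them to length 1.
  have hone : ∑ s, H.init s * H.onesGen δ 1 s < 1 := by
    rw [← sum_init_onesGen, wordSum_one]
    have h2 := H.wordSum_wordProb 1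
    rw [wordSum_one] at h2
    have h3 : 0 < H.wordProb [true] := hnd
    simp
    nlinarith
  obtain ⟨ν, hν0, hν1, hνs, hνo⟩ : ∃ ν : ℝ, 0 < ν ∧ ν < 1 ∧ (∀ s, H.onesGen δ K₁ s ≤ ν) ∧
      ∑ s, H.init s * H.onesGen δ 1 s ≤ ν := by
    rcases isEmpty_or_nonempty S with hS | hS
    · exact ⟨1 / 2, by norm_num, by norm_num, fun s => isEmptyElim s, by simp⟩
    obtain ⟨s₀, hs₀⟩ := Finite.exists_max (H.onesGen δ K₁)
    refine ⟨max (max (H.onesGen δ K₁ s₀) (∑ s, H.init s * H.onesGen δ 1 s)) (1 / 2), ?_, ?_, ?_, ?_⟩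
    · exact lt_max_of_lt_right (by norm_num)
    · exact max_lt (max_lt (hlt s₀) hone) (by norm_num)
    · exact fun s => (hs₀ s).trans ((le_max_left _ _).trans (le_max_left _ _))
    · exact (le_max_right _ _).trans (le_max_left _ _)
  have hr : (2 * K₁) ≠ 0 := by simp [K₁]
  -- The 2 absorbs the rounding: `2 * K₁ * (L / K₁) ≥ L` once `L ≥ K₁`.
  refine ⟨ν ^ ((2 * K₁ : ℕ) : ℝ)⁻¹, by positivity, Real.rpow_lt_one hν0.le hν1 (by positivity), ?_⟩
  set ρ := ν ^ ((2 * K₁ : ℕ) : ℝ)⁻¹ with hρ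
  have hρ0 : 0 ≤ ρ := by positivity
  have hρ1 : ρ ≤ 1 := (Real.rpow_lt_one hν0.le hν1 (by positivity)).le
  have hρν : ρ ^ (2 * K₁) = ν := Real.rpow_inv_natCast_pow hν0.le hr
  intro L
  rw [sum_init_onesGen]
  have avg : ∀ (K : ℕ) (c : ℝ), (∀ s, H.onesGen δ K s ≤ c) →
      ∑ s, H.init s * H.onesGen δ K s ≤ c := by
    intro K c hc
    calc _ ≤ ∑ s, H.init s * c :=
          Finset.sum_le_sum fun s _ => mul_le_mul_of_nonneg_left (hc s) (H.init_nonneg s)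
      _ = c := by rw [← Finset.sum_mul, H.init_sum, one_mul]
  rcases Nat.eq_zero_or_pos L with rfl | hL
  · simpa using avg 0 1 (fun s => by simp [onesGen_zero])
  rcases lt_or_ge L K₁ with hLK | hLK
  · calc ∑ s, H.init s * H.onesGen δ L s ≤ ∑ s, H.init s * H.onesGen δ 1 s :=
          Finset.sum_le_sum fun s _ =>
            mul_le_mul_of_nonneg_left (H.onesGen_antitone h0 h1.le s hL) (H.init_nonneg s)
      _ ≤ ν := hνo
      _ = ρ ^ (2 * K₁) := hρν.symm
      _ ≤ ρ ^ L := pow_le_pow_of_le_one hρ0 hρ1 (by omega)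
  · calc ∑ s, H.init s * H.onesGen δ L s ≤ ν ^ (L / K₁) := by
          refine avg L _ fun s => ?_
          exact (H.onesGen_antitone h0 h1.le s (Nat.div_mul_le_self L K₁)).trans
            (H.onesGen_mul_le h0 hν0.le hνs _ s)
      _ = ρ ^ (2 * K₁ * (L / K₁)) := by rw [← hρν, ← pow_mul]
      _ ≤ ρ ^ L := by
          refine pow_le_pow_of_le_one hρ0 hρ1 ?_
          have h3 : 1 ≤ L / K₁ := (Nat.one_le_div_iff (by simp [K₁])).2 hLK
          have h4 := Nat.div_add_mod L K₁
          have h5 := Nat.mod_lt L (show 0 < K₁ by simp [K₁])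
          nlinarith

end HiddenMarkov

/-! ### Decomposition of an outcome into two halves and a guard-band, and the resulting laws. -/

namespace TDC

/-- Transport of a vector along an equality of lengths. -/
def castVec {a b : ℕ} (h : a = b) : (Fin a → Bool) ≃ (Fin b → Bool) :=
  Equiv.arrowCongr (finCongr h) (Equiv.refl Bool)

theorem ofFn_castVec {a b : ℕ} (h : a = b) (x : Fin a → Bool) :
    List.ofFn (castVec h x) = List.ofFn x := by
  subst h
  rfl

theorem ofFn_appendEquiv {a b : ℕ} (x : Fin a → Bool) (y : Fin b → Bool) :
    List.ofFn (Fin.appendEquiv a b (x, y)) = List.ofFn x ++ List.ofFn y := by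
  simp [Fin.appendEquiv, List.ofFn_fin_append]

/-- The length of the guard-band between the two halves of a word of length `2 ^ (n + 1)`. -/
noncomputable def midLen (ξ : ℝ) (n₀ n : ℕ) : ℕ :=
  if n + 1 ≤ n₀ then 0 else guardLen ξ (n + 1)

theorem midLen_of_le {ξ : ℝ} {n₀ n : ℕ} (h : n₀ ≤ n) : midLen ξ n₀ n = guardLen ξ (n + 1) := by
  simp [midLen, Nat.not_le.2 (Nat.lt_succ_of_le h)]

theorem fullLen_of_le {ξ : ℝ} {n₀ n : ℕ} (h : n ≤ n₀) : fullLen ξ n₀ n = 2 ^ n := by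
  cases n with
  | zero => simp [fullLen]
  | succ n => simp [fullLen, h]

theorem fullLen_succ (ξ : ℝ) (n₀ n : ℕ) :
    fullLen ξ n₀ (n + 1) = fullLen ξ n₀ n + (midLen ξ n₀ n + fullLen ξ n₀ n) := by
  unfold midLen
  split_ifs with h
  · rw [fullLen_of_le h, fullLen_of_le (by omega : n ≤ n₀), pow_succ]; omega
  · rw [fullLen, if_neg h, add_assoc]

theorem addGuards_of_le {ξ : ℝ} {n₀ n : ℕ} (h : n ≤ n₀) (x : Fin (2 ^ n) → Bool) :
    addGuards ξ n₀ n x = List.ofFn x := by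
  cases n with
  | zero => simp [addGuards]
  | succ n => simp [addGuards, h]

/-- The word with given halves. -/
def joinHalves (n : ℕ) :
    (Fin (2 ^ n) → Bool) × (Fin (2 ^ n) → Bool) ≃ (Fin (2 ^ (n + 1)) → Bool) :=
  (Fin.appendEquiv (2 ^ n) (2 ^ n)).trans (castVec (by rw [pow_succ, mul_two]))

theorem ofFn_joinHalves {n : ℕ} (x y : Fin (2 ^ n) → Bool) :
    List.ofFn (joinHalves n (x, y)) = List.ofFn x ++ List.ofFn y := by
  simp [joinHalves, ofFn_castVec, ofFn_appendEquiv]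

theorem firstHalf_joinHalves {n : ℕ} (x y : Fin (2 ^ n) → Bool) :
    firstHalf (joinHalves n (x, y)) = x := by
  funext k
  simp only [firstHalf, joinHalves, castVec, Equiv.trans_apply, Equiv.arrowCongr_apply,
    Equiv.coe_refl, Function.comp, id, Fin.appendEquiv_apply]
  exact Fin.append_left x y k

theorem secondHalf_joinHalves {n : ℕ} (x y : Fin (2 ^ n) → Bool) :
    secondHalf (joinHalves n (x, y)) = y := by
  funext k
  simp only [secondHalf, joinHalves, castVec, Equiv.trans_apply, Equiv.arrowCongr_apply,
    Equiv.coe_refl, Function.comp, id, Fin.appendEquiv_apply]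
  exact Fin.append_right x y k

theorem addGuards_joinHalves (ξ : ℝ) (n₀ : ℕ) {n : ℕ} (x y : Fin (2 ^ n) → Bool) :
    addGuards ξ n₀ (n + 1) (joinHalves n (x, y)) =
      addGuards ξ n₀ n x ++ (List.replicate (midLen ξ n₀ n) false ++ addGuards ξ n₀ n y) := by
  unfold midLen
  split_ifs with h
  · rw [addGuards_of_le h, addGuards_of_le (by omega : n ≤ n₀),
      addGuards_of_le (by omega : n ≤ n₀), ofFn_joinHalves]
    simp
  · rw [addGuards, if_neg h, firstHalf_joinHalves, secondHalf_joinHalves, List.append_assoc]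

/-- The outcome that is made up of the outcomes for the two halves and the deletion pattern of
the guard-band between them. -/
noncomputable def joinOutcome (ξ : ℝ) (n₀ n : ℕ) :
    Outcome ξ n₀ n × (Fin (midLen ξ n₀ n) → Bool) × Outcome ξ n₀ n ≃ Outcome ξ n₀ (n + 1) where
  toFun ω := (joinHalves n (ω.1.1, ω.2.2.1),
    castVec (fullLen_succ ξ n₀ n).symm
      (Fin.appendEquiv _ _ (ω.1.2, Fin.appendEquiv _ _ (ω.2.1, ω.2.2.2))))
  invFun ω :=
    let x := (joinHalves n).symm ω.1
    let d := (Fin.appendEquiv _ _).symm ((castVec (fullLen_succ ξ n₀ n)) ω.2)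
    let e := (Fin.appendEquiv _ _).symm d.2
    ((x.1, d.1), e.1, (x.2, e.2))
  left_inv ω := by
    have : ∀ v, castVec (fullLen_succ ξ n₀ n) (castVec (fullLen_succ ξ n₀ n).symm v) = v :=
      fun v => rfl
    simp only [this, Equiv.symm_apply_apply]
  right_inv ω := by
    have : ∀ v, castVec (fullLen_succ ξ n₀ n).symm (castVec (fullLen_succ ξ n₀ n) v) = v :=
      fun v => rfl
    simp only [Equiv.apply_symm_apply, Prod.mk.eta, this]

variable {ξ : ℝ} {n₀ n : ℕ}

theorem ofFn_joinOutcome_snd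
    (ω : Outcome ξ n₀ n × (Fin (midLen ξ n₀ n) → Bool) × Outcome ξ n₀ n) :
    List.ofFn (joinOutcome ξ n₀ n ω).2
      = List.ofFn ω.1.2 ++ (List.ofFn ω.2.1 ++ List.ofFn ω.2.2.2) := by
  simp only [joinOutcome, Equiv.coe_fn_mk, ofFn_castVec, ofFn_appendEquiv]

/-- The output of the deletion channel for the input `g(X, n₀, ξ)`. -/
noncomputable def outWord (ω : Outcome ξ n₀ n) : List Bool :=
  survivors (addGuards ξ n₀ n ω.1) (List.ofFn ω.2)

/-- What is left of a guard-band of length `k`. -/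
def guardWord {k : ℕ} (e : Fin k → Bool) : List Bool :=
  survivors (List.replicate k false) (List.ofFn e)

theorem true_notMem_guardWord {k : ℕ} (e : Fin k → Bool) : true ∉ guardWord e := by
  intro h
  have := survivors_subset _ _ h
  simp at this

theorem outWord_joinOutcome
    (ω : Outcome ξ n₀ n × (Fin (midLen ξ n₀ n) → Bool) × Outcome ξ n₀ n) :
    outWord (joinOutcome ξ n₀ n ω) = outWord ω.1 ++ (guardWord ω.2.1 ++ outWord ω.2.2) := by
  unfold outWord guardWord
  rw [ofFn_joinOutcome_snd]
  have : (joinOutcome ξ n₀ n ω).1 = joinHalves n (ω.1.1, ω.2.2.1) := rfl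
  rw [this, addGuards_joinHalves, survivors_append (by simp [length_addGuards]),
    survivors_append (by simp)]

theorem outYI_joinOutcome
    (ω : Outcome ξ n₀ n × (Fin (midLen ξ n₀ n) → Bool) × Outcome ξ n₀ n) :
    outYI (joinOutcome ξ n₀ n ω) = outWord ω.1 := by
  unfold outYI outWord
  rw [ofFn_joinOutcome_snd, List.take_left' (by simp)]
  change survivors (addGuards ξ n₀ n (firstHalf (joinHalves n (ω.1.1, ω.2.2.1)))) _ = _
  rw [firstHalf_joinHalves]

theorem outYII_joinOutcome (h : n₀ ≤ n)
    (ω : Outcome ξ n₀ n × (Fin (midLen ξ n₀ n) → Bool) × Outcome ξ n₀ n) :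
    outYII (joinOutcome ξ n₀ n ω) = outWord ω.2.2 := by
  unfold outYII outWord
  rw [ofFn_joinOutcome_snd, ← List.append_assoc,
    List.drop_left' (by simp [midLen_of_le h])]
  change survivors (addGuards ξ n₀ n (secondHalf (joinHalves n (ω.1.1, ω.2.2.1)))) _ = _
  rw [secondHalf_joinHalves]

theorem trim_outZI_joinOutcome
    (ω : Outcome ξ n₀ n × (Fin (midLen ξ n₀ n) → Bool) × Outcome ξ n₀ n) :
    trim (outZI (joinOutcome ξ n₀ n ω)) = trim (outWord ω.1) := by
  rw [outZI, trim_trimmedPart, outYI_joinOutcome]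

theorem trim_outZII_joinOutcome (h : n₀ ≤ n)
    (ω : Outcome ξ n₀ n × (Fin (midLen ξ n₀ n) → Bool) × Outcome ξ n₀ n) :
    trim (outZII (joinOutcome ξ n₀ n ω)) = trim (outWord ω.2.2) := by
  rw [outZII, trim_trimmedPart, outYII_joinOutcome h]

theorem length_outWord_le (ω : Outcome ξ n₀ n) : (outWord ω).length ≤ fullLen ξ n₀ n := by
  have := length_survivors_le (addGuards ξ n₀ n ω.1) (List.ofFn ω.2)
  rwa [length_addGuards] at this

section Law

variable {S : Type*} [Fintype S] {H : HiddenMarkov S} {δ : ℝ}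

theorem inputProb_of_le (h : n ≤ n₀) (x : Fin (2 ^ n) → Bool) :
    inputProb H n₀ n x = H.wordProb (List.ofFn x) := by
  cases n with
  | zero => simp [inputProb]
  | succ n => simp [inputProb, h]

theorem inputProb_joinHalves (h : n₀ ≤ n) (x y : Fin (2 ^ n) → Bool) :
    inputProb H n₀ (n + 1) (joinHalves n (x, y)) = inputProb H n₀ n x * inputProb H n₀ n y := by
  rw [inputProb, if_neg (by omega), firstHalf_joinHalves, secondHalf_joinHalves]

theorem inputProb_nonneg (x : Fin (2 ^ n) → Bool) : 0 ≤ inputProb H n₀ n x := by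
  induction n with
  | zero => exact H.wordProb_nonneg _
  | succ n ih =>
    rw [inputProb]
    split_ifs
    · exact H.wordProb_nonneg _
    · exact mul_nonneg (ih _) (ih _)

theorem sum_inputProb : ∑ x, inputProb H n₀ n x = 1 := by
  rcases le_or_gt n n₀ with h | h
  · simp only [inputProb_of_le h]
    exact H.wordSum_wordProb (2 ^ n)
  · induction n with
    | zero => omega
    | succ n ih =>
      have key : ∑ x, inputProb H n₀ n x = 1 := by
        rcases (Nat.lt_succ_iff.1 h).lt_or_eq with h' | rfl
        · exact ih h'
        · simp only [inputProb_of_le le_rfl]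
          exact H.wordSum_wordProb _
      rw [← Equiv.sum_comp (joinHalves n), Fintype.sum_prod_type]
      simp only [inputProb_joinHalves (Nat.lt_succ_iff.1 h), ← Finset.mul_sum, key, mul_one]

theorem sum_inputProb_joinHalves_right (x : Fin (2 ^ n) → Bool) :
    ∑ y, inputProb H n₀ (n + 1) (joinHalves n (x, y)) = inputProb H n₀ n x := by
  rcases le_or_gt n₀ n with h | h
  · simp only [inputProb_joinHalves h, ← Finset.mul_sum, sum_inputProb, mul_one]
  · simp only [inputProb_of_le (Nat.succ_le_of_lt h), inputProb_of_le h.le, ofFn_joinHalves]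
    exact H.wordSum_wordProb_append_right (2 ^ n) (List.ofFn x)

theorem sum_inputProb_joinHalves_left
    (hst : ∀ s', ∑ s, H.init s * H.trans s s' = H.init s') (y : Fin (2 ^ n) → Bool) :
    ∑ x, inputProb H n₀ (n + 1) (joinHalves n (x, y)) = inputProb H n₀ n y := by
  rcases le_or_gt n₀ n with h | h
  · simp only [inputProb_joinHalves h, ← Finset.sum_mul, sum_inputProb, one_mul]
  · simp only [inputProb_of_le (Nat.succ_le_of_lt h), inputProb_of_le h.le, ofFn_joinHalves]
    exact HiddenMarkov.wordSum_wordProb_append_left hst (2 ^ n) (List.ofFn y)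

theorem outcomeProb_eq (ω : Outcome ξ n₀ n) :
    outcomeProb H δ ξ n₀ n ω = inputProb H n₀ n ω.1 * delWeight δ (List.ofFn ω.2) := by
  rw [delWeight_ofFn]
  rfl

theorem outcomeProb_nonneg (h0 : 0 ≤ δ) (h1 : δ ≤ 1) (ω : Outcome ξ n₀ n) :
    0 ≤ outcomeProb H δ ξ n₀ n ω := by
  rw [outcomeProb_eq]
  exact mul_nonneg (inputProb_nonneg _) (delWeight_nonneg h0 h1 _)

theorem sum_outcomeProb_mul (f : (Fin (2 ^ n) → Bool) → List Bool → ℝ) :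
    ∑ ω : Outcome ξ n₀ n, outcomeProb H δ ξ n₀ n ω * f ω.1 (List.ofFn ω.2)
      = ∑ x, inputProb H n₀ n x * wordSum (fullLen ξ n₀ n) (fun d => delWeight δ d * f x d) := by
  rw [Fintype.sum_prod_type]
  refine Finset.sum_congr rfl fun x _ => ?_
  rw [wordSum, Finset.mul_sum]
  refine Finset.sum_congr rfl fun d _ => ?_
  rw [outcomeProb_eq]
  ring

theorem sum_outcomeProb : ∑ ω, outcomeProb H δ ξ n₀ n ω = 1 := by
  have := sum_outcomeProb_mul (H := H) (δ := δ) (ξ := ξ) (n₀ := n₀) (n := n) (fun _ _ => 1)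
  simpa [wordSum_delWeight, sum_inputProb] using this

theorem sum_outcomeProb_mul_pow_length (c : ℝ) :
    ∑ ω : Outcome ξ n₀ n, outcomeProb H δ ξ n₀ n ω * c ^ (outWord ω).length
      = (δ + (1 - δ) * c) ^ fullLen ξ n₀ n := by
  refine (sum_outcomeProb_mul
    (fun x d => c ^ (survivors (addGuards ξ n₀ n x) d).length)).trans ?_
  have : ∀ x, wordSum (fullLen ξ n₀ n)
      (fun d => delWeight δ d * c ^ (survivors (addGuards ξ n₀ n x) d).length)
      = (δ + (1 - δ) * c) ^ fullLen ξ n₀ n := by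
    intro x
    have := wordSum_delWeight_mul_pow_length δ c (addGuards ξ n₀ n x)
    rwa [length_addGuards] at this
  simp only [this, ← Finset.sum_mul, sum_inputProb, one_mul]

theorem prob_outWord_no_true :
    prob (outcomeProb H δ ξ n₀ n) (fun ω => true ∉ outWord ω)
      = ∑ x, inputProb H n₀ n x * δ ^ (addGuards ξ n₀ n x).count true := by
  have h1 : prob (outcomeProb H δ ξ n₀ n) (fun ω => true ∉ outWord ω)
      = ∑ ω : Outcome ξ n₀ n, outcomeProb H δ ξ n₀ n ω *
        if true ∈ survivors (addGuards ξ n₀ n ω.1) (List.ofFn ω.2) then 0 else 1 := by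
    unfold prob
    refine Finset.sum_congr rfl fun ω _ => ?_
    by_cases h : true ∈ outWord ω
    · have h' := h
      unfold outWord at h'
      simp [h, h']
    · have h' := h
      unfold outWord at h'
      simp [h, h']
  rw [h1]
  refine (sum_outcomeProb_mul
    (fun x d => if true ∈ survivors (addGuards ξ n₀ n x) d then 0 else 1)).trans ?_
  refine Finset.sum_congr rfl fun x _ => ?_
  have := wordSum_delWeight_no_true δ (addGuards ξ n₀ n x)
  rw [length_addGuards] at this
  rw [this]

theorem outcomeProb_joinOutcome
    (ω : Outcome ξ n₀ n × (Fin (midLen ξ n₀ n) → Bool) × Outcome ξ n₀ n) :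
    outcomeProb H δ ξ n₀ (n + 1) (joinOutcome ξ n₀ n ω)
      = inputProb H n₀ (n + 1) (joinHalves n (ω.1.1, ω.2.2.1)) *
        (delWeight δ (List.ofFn ω.1.2) * (delWeight δ (List.ofFn ω.2.1) *
          delWeight δ (List.ofFn ω.2.2.2))) := by
  rw [outcomeProb_eq, ofFn_joinOutcome_snd, delWeight_append, delWeight_append]
  rfl

theorem outcomeProb_joinOutcome_of_le (h : n₀ ≤ n) :
    (fun ω => outcomeProb H δ ξ n₀ (n + 1) (joinOutcome ξ n₀ n ω))
      = tripleWeight (outcomeProb H δ ξ n₀ n) (fun e => delWeight δ (List.ofFn e)) := by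
  funext ω
  rw [outcomeProb_joinOutcome, inputProb_joinHalves h, tripleWeight, outcomeProb_eq,
    outcomeProb_eq]
  ring

theorem sum_delWeight_ofFn (k : ℕ) : ∑ e : Fin k → Bool, delWeight δ (List.ofFn e) = 1 :=
  wordSum_delWeight δ k

/-- Inside a block, that is for `n < n₀`, the halves are dependent; only this marginal statement
holds at every level. -/
theorem prob_joinOutcome_fst (E : Outcome ξ n₀ n → Prop) :
    prob (fun ω => outcomeProb H δ ξ n₀ (n + 1) (joinOutcome ξ n₀ n ω)) (fun ω => E ω.1)
      = prob (outcomeProb H δ ξ n₀ n) E := by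
  classical
  unfold prob
  rw [Fintype.sum_prod_type]
  refine Finset.sum_congr rfl fun ω _ => ?_
  by_cases hE : E ω
  · simp only [hE, if_true, Fintype.sum_prod_type, outcomeProb_joinOutcome, ← Finset.mul_sum,
      ← Finset.sum_mul, sum_delWeight_ofFn, mul_one, sum_inputProb_joinHalves_right]
    rw [outcomeProb_eq]
  · simp [hE]

theorem prob_joinOutcome_snd (hst : ∀ s', ∑ s, H.init s * H.trans s s' = H.init s')
    (E : Outcome ξ n₀ n → Prop) :
    prob (fun ω => outcomeProb H δ ξ n₀ (n + 1) (joinOutcome ξ n₀ n ω)) (fun ω => E ω.2.2)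
      = prob (outcomeProb H δ ξ n₀ n) E := by
  classical
  unfold prob
  have swap : ∀ f : Outcome ξ n₀ n × (Fin (midLen ξ n₀ n) → Bool) × Outcome ξ n₀ n → ℝ,
      ∑ ω, f ω = ∑ ω₂, ∑ e, ∑ d₁, ∑ x₁, f ((x₁, d₁), e, ω₂) := by
    intro f
    rw [Fintype.sum_prod_type_right, Fintype.sum_prod_type_right]
    exact Finset.sum_congr rfl fun _ _ => Finset.sum_congr rfl fun _ _ =>
      Fintype.sum_prod_type_right _
  rw [swap]
  refine Finset.sum_congr rfl fun ω _ => ?_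
  by_cases hE : E ω
  · simp only [hE, if_true, outcomeProb_joinOutcome, ← Finset.mul_sum,
      ← Finset.sum_mul, sum_delWeight_ofFn, one_mul, sum_inputProb_joinHalves_left hst]
    rw [outcomeProb_eq]
  · simp [hE]

/-- With high probability, at least one symbol `1` of the input survives. -/
theorem prob_outWord_no_true_le {ρ : ℝ} (h0 : 0 ≤ δ) (h1 : δ ≤ 1)
    (hρ : ∀ L, wordSum L (fun w => H.wordProb w * δ ^ w.count true) ≤ ρ ^ L) (n : ℕ) :
    prob (outcomeProb H δ ξ n₀ n) (fun ω => true ∉ outWord ω) ≤ ρ ^ 2 ^ n := by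
  rcases le_or_gt n n₀ with h | h
  · rw [prob_outWord_no_true]
    simp only [inputProb_of_le h, addGuards_of_le h]
    exact hρ (2 ^ n)
  · induction n with
    | zero => omega
    | succ n ih =>
      have hn : n₀ ≤ n := Nat.lt_succ_iff.1 h
      have key : prob (outcomeProb H δ ξ n₀ n) (fun ω => true ∉ outWord ω) ≤ ρ ^ 2 ^ n := by
        rcases hn.lt_or_eq with h' | rfl
        · exact ih h'
        · rw [prob_outWord_no_true]
          simp only [inputProb_of_le le_rfl, addGuards_of_le le_rfl]
          exact hρ _
      rw [prob_equiv (joinOutcome ξ n₀ n), outcomeProb_joinOutcome_of_le hn]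
      have hp := outcomeProb_nonneg (H := H) (ξ := ξ) (n₀ := n₀) (n := n) h0 h1
      have hw : ∀ e : Fin (midLen ξ n₀ n) → Bool, 0 ≤ delWeight δ (List.ofFn e) :=
        fun e => delWeight_nonneg h0 h1 _
      -- Above the block level both independent halves must lose all their ones, so the bound is
      -- squared as the length doubles.
      refine (prob_mono (tripleWeight_nonneg hp hw)
        (F := fun ω => true ∉ outWord ω.1 ∧ true ∉ outWord ω.2.2) ?_).trans ?_
      · intro ω
        rw [outWord_joinOutcome]
        simp only [List.mem_append, not_or]
        exact fun h => ⟨h.1, h.2.2⟩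
      · rw [prob_tripleWeight_and (sum_delWeight_ofFn _) (fun ω => true ∉ outWord ω)
          (fun ω => true ∉ outWord ω), pow_succ, pow_mul, sq]
        have := prob_nonneg hp (fun ω => true ∉ outWord ω)
        exact mul_le_mul key key this (this.trans key)

/-- The output of the initial subword of length `2 ^ j` fits into the first `fullLen ξ n₀ j` output
symbols. If these contain no `1`, every `1` of that subword was deleted. -/
theorem prob_no_true_take_le {ρ : ℝ} (h0 : 0 ≤ δ) (h1 : δ ≤ 1)
    (hρ : ∀ L, wordSum L (fun w => H.wordProb w * δ ^ w.count true) ≤ ρ ^ L) {j n : ℕ}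
    (hj : j ≤ n) :
    prob (outcomeProb H δ ξ n₀ n) (fun ω => true ∉ (outWord ω).take (fullLen ξ n₀ j))
      ≤ ρ ^ 2 ^ j := by
  induction n, hj using Nat.le_induction with
  | base =>
    refine le_trans (le_of_eq (prob_congr fun ω => ?_)) (prob_outWord_no_true_le h0 h1 hρ j)
    rw [List.take_of_length_le (length_outWord_le ω)]
  | succ n _ ih =>
    refine le_trans ?_ ih
    rw [prob_equiv (joinOutcome ξ n₀ n), ← prob_joinOutcome_fst]
    refine prob_mono (fun ω => outcomeProb_nonneg h0 h1 _) fun ω h => ?_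
    rw [outWord_joinOutcome, List.take_append, List.mem_append, not_or] at h
    exact h.1

theorem prob_no_true_reverse_take_le {ρ : ℝ} (h0 : 0 ≤ δ) (h1 : δ ≤ 1)
    (hst : ∀ s', ∑ s, H.init s * H.trans s s' = H.init s')
    (hρ : ∀ L, wordSum L (fun w => H.wordProb w * δ ^ w.count true) ≤ ρ ^ L) {j n : ℕ}
    (hj : j ≤ n) :
    prob (outcomeProb H δ ξ n₀ n) (fun ω => true ∉ (outWord ω).reverse.take (fullLen ξ n₀ j))
      ≤ ρ ^ 2 ^ j := by
  induction n, hj using Nat.le_induction with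
  | base =>
    refine le_trans (le_of_eq (prob_congr fun ω => ?_)) (prob_outWord_no_true_le h0 h1 hρ j)
    rw [List.take_of_length_le (by simpa using length_outWord_le ω), List.mem_reverse]
  | succ n _ ih =>
    refine le_trans ?_ ih
    rw [prob_equiv (joinOutcome ξ n₀ n), ← prob_joinOutcome_snd hst]
    refine prob_mono (fun ω => outcomeProb_nonneg h0 h1 _) fun ω h => ?_
    rw [outWord_joinOutcome, ← List.append_assoc, List.reverse_append, List.take_append,
      List.mem_append, not_or] at h
    exact h.1

end Law

end TDC

/-! ### Index bookkeeping for the Arıkan transform. -/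

namespace TDC

theorem past_eq_iff {N : ℕ} (u v : Fin N → Bool) (i : Fin N) :
    past u i = past v i ↔ ∀ k : Fin N, k < i → u k = v k := by
  unfold past
  constructor
  · intro h k hk
    have h1 : (List.ofFn u).take i = (List.ofFn v).take i := h
    have h2 := congrArg (fun l : List Bool => l[(k : ℕ)]?) h1
    simpa [List.getElem?_take, hk, List.getElem?_ofFn] using h2
  · intro h
    apply List.ext_getElem
    · simp
    · intro k h1 h2
      simp only [List.getElem_take, List.getElem_ofFn]
      refine h _ ?_
      rw [Fin.lt_def]
      simp only [List.length_take] at h1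
      exact lt_of_lt_of_le h1 (min_le_left _ _)

section Arikan

variable {n : ℕ}

/-- The position `2 k + c`, where `c` is `0` or `1`. -/
def doubleIndex (k : Fin (2 ^ n)) (c : Fin 2) : Fin (2 ^ (n + 1)) :=
  ⟨2 * k + c, by have := k.2; have := c.2; rw [pow_succ]; omega⟩

theorem arikan_doubleIndex_zero (x : Fin (2 ^ (n + 1)) → Bool) (k : Fin (2 ^ n)) :
    arikan (n + 1) x (doubleIndex k 0) =
      xor (arikan n (firstHalf x) k) (arikan n (secondHalf x) k) := by
  have h : halfIndex (doubleIndex k 0) = k := by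
    apply Fin.ext
    simp [halfIndex, doubleIndex]
  simp only [arikan, h]
  rw [if_pos (by simp [doubleIndex])]

theorem arikan_doubleIndex_one (x : Fin (2 ^ (n + 1)) → Bool) (k : Fin (2 ^ n)) :
    arikan (n + 1) x (doubleIndex k 1) = arikan n (secondHalf x) k := by
  have h : halfIndex (doubleIndex k 1) = k := by
    apply Fin.ext
    simp [halfIndex, doubleIndex]
    omega
  simp only [arikan, h]
  rw [if_neg (by simp [doubleIndex])]

/-- The zero-based coordinates `2k` and `2k + 1` of `U` determine coordinate `k` of both half
transforms: the odd one gives the second half, and adding it to the even one gives the first. -/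
theorem past_halves_eq {x y : Fin (2 ^ (n + 1)) → Bool} {i : Fin (2 ^ (n + 1))}
    (h : past (arikan (n + 1) x) i = past (arikan (n + 1) y) i) :
    past (arikan n (firstHalf x)) (halfIndex i) = past (arikan n (firstHalf y)) (halfIndex i) ∧
    past (arikan n (secondHalf x)) (halfIndex i) = past (arikan n (secondHalf y)) (halfIndex i) := by
  rw [past_eq_iff] at h
  have h2 : ∀ k, k < halfIndex i → arikan n (secondHalf x) k = arikan n (secondHalf y) k := by
    intro k hk
    have := h (doubleIndex k 1) (by
      rw [Fin.lt_def] at hk ⊢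
      simp only [halfIndex, doubleIndex] at hk ⊢
      simp
      omega)
    rwa [arikan_doubleIndex_one, arikan_doubleIndex_one] at this
  have h1 : ∀ k, k < halfIndex i → arikan n (firstHalf x) k = arikan n (firstHalf y) k := by
    intro k hk
    have := h (doubleIndex k 0) (by
      rw [Fin.lt_def] at hk ⊢
      simp only [halfIndex, doubleIndex] at hk ⊢
      simp
      omega)
    rw [arikan_doubleIndex_zero, arikan_doubleIndex_zero, h2 k hk] at this
    exact Bool.xor_left_inj.1 this
  exact ⟨(past_eq_iff _ _ _).2 h1, (past_eq_iff _ _ _).2 h2⟩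

theorem xor_halves_eq {x y : Fin (2 ^ (n + 1)) → Bool} {i : Fin (2 ^ (n + 1))}
    (hi : (i : ℕ) % 2 ≠ 0)
    (h : past (arikan (n + 1) x) i = past (arikan (n + 1) y) i) :
    xor (arikan n (firstHalf x) (halfIndex i)) (arikan n (secondHalf x) (halfIndex i)) =
      xor (arikan n (firstHalf y) (halfIndex i)) (arikan n (secondHalf y) (halfIndex i)) := by
  rw [past_eq_iff] at h
  have := h (doubleIndex (halfIndex i) 0) (by
    rw [Fin.lt_def]
    simp only [halfIndex, doubleIndex]
    simp
    omega)
  rwa [arikan_doubleIndex_zero, arikan_doubleIndex_zero] at this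

end Arikan

/-! ### The minus and plus bounds, the Chernoff estimates and the recovery of both halves. -/

section SingleStep

variable {S : Type*} [Fintype S] {H : HiddenMarkov S} {δ ξ : ℝ} {n₀ n : ℕ}

theorem firstHalf_joinOutcome
    (ω : Outcome ξ n₀ n × (Fin (midLen ξ n₀ n) → Bool) × Outcome ξ n₀ n) :
    firstHalf (joinOutcome ξ n₀ n ω).1 = ω.1.1 :=
  firstHalf_joinHalves _ _

theorem secondHalf_joinOutcome
    (ω : Outcome ξ n₀ n × (Fin (midLen ξ n₀ n) → Bool) × Outcome ξ n₀ n) :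
    secondHalf (joinOutcome ξ n₀ n ω).1 = ω.2.2.1 :=
  secondHalf_joinHalves _ _

/-- By `trim_trimmedPart`, `Z_I*` depends on the first half alone, so the parameter lives on a
single factor of the product space. -/
theorem zHalf_eq (h : n₀ ≤ n) (j : Fin (2 ^ n)) :
    zHalf H δ ξ n₀ n j = bhattacharyya (outcomeProb H δ ξ n₀ n) (fun ω => arikan n ω.1 j)
      (fun ω => (past (arikan n ω.1) j, trim (outWord ω))) := by
  rw [zHalf, bhattacharyya_equiv (joinOutcome ξ n₀ n), outcomeProb_joinOutcome_of_le h]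
  simp only [firstHalf_joinOutcome, trim_outZI_joinOutcome]
  exact bhattacharyya_tripleWeight_fst sum_outcomeProb (sum_delWeight_ofFn _)
    (fun ω : Outcome ξ n₀ n => arikan n ω.1 j)
    (fun ω => (past (arikan n ω.1) j, trim (outWord ω)))

theorem zPair_eq (h : n₀ ≤ n) (i : Fin (2 ^ (n + 1))) :
    zPair H δ ξ n₀ n i = bhattacharyya
      (tripleWeight (outcomeProb H δ ξ n₀ n)
        (fun e : Fin (midLen ξ n₀ n) → Bool => delWeight δ (List.ofFn e)))
      (fun ω => arikan (n + 1) (joinOutcome ξ n₀ n ω).1 i)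
      (fun ω => (past (arikan (n + 1) (joinOutcome ξ n₀ n ω).1) i, trim (outWord ω.1),
        trim (outWord ω.2.2))) := by
  rw [zPair, bhattacharyya_equiv (joinOutcome ξ n₀ n), outcomeProb_joinOutcome_of_le h]
  simp only [trim_outZI_joinOutcome, trim_outZII_joinOutcome h]

theorem zPair_le_of_even (h0 : 0 ≤ δ) (h1 : δ ≤ 1) (h : n₀ ≤ n) {i : Fin (2 ^ (n + 1))}
    (hi : (i : ℕ) % 2 = 0) :
    zPair H δ ξ n₀ n i ≤ 2 * zHalf H δ ξ n₀ n (halfIndex i) := by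
  have hp := outcomeProb_nonneg (H := H) (ξ := ξ) (n₀ := n₀) (n := n) h0 h1
  have hw : ∀ e : Fin (midLen ξ n₀ n) → Bool, 0 ≤ delWeight δ (List.ofFn e) :=
    fun e => delWeight_nonneg h0 h1 _
  rw [zPair_eq h, zHalf_eq h]
  refine le_trans ?_ (bhattacharyya_minus_le hp hw sum_outcomeProb (sum_delWeight_ofFn _) _ _)
  have : ∀ ω, arikan (n + 1) (joinOutcome ξ n₀ n ω).1 i
      = xor (arikan n ω.1.1 (halfIndex i)) (arikan n ω.2.2.1 (halfIndex i)) := by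
    intro ω
    simp only [arikan, hi, if_true, firstHalf_joinOutcome, secondHalf_joinOutcome]
  simp only [this]
  refine bhattacharyya_le_of_factorsThrough (tripleWeight_nonneg hp hw) _ ?_
  intro ω ω' hω
  simp only [Prod.mk.injEq] at hω ⊢
  have := past_halves_eq hω.1
  simp only [firstHalf_joinOutcome, secondHalf_joinOutcome] at this
  exact ⟨⟨this.1, hω.2.1⟩, this.2, hω.2.2⟩

theorem zPair_le_of_odd (h0 : 0 ≤ δ) (h1 : δ ≤ 1) (h : n₀ ≤ n) {i : Fin (2 ^ (n + 1))}
    (hi : (i : ℕ) % 2 ≠ 0) :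
    zPair H δ ξ n₀ n i ≤ zHalf H δ ξ n₀ n (halfIndex i) ^ 2 := by
  have hp := outcomeProb_nonneg (H := H) (ξ := ξ) (n₀ := n₀) (n := n) h0 h1
  have hw : ∀ e : Fin (midLen ξ n₀ n) → Bool, 0 ≤ delWeight δ (List.ofFn e) :=
    fun e => delWeight_nonneg h0 h1 _
  rw [zPair_eq h, zHalf_eq h, ← bhattacharyya_plus hp
    (sum_delWeight_ofFn (δ := δ) (midLen ξ n₀ n))]
  have : ∀ ω, arikan (n + 1) (joinOutcome ξ n₀ n ω).1 i = arikan n ω.2.2.1 (halfIndex i) := by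
    intro ω
    simp only [arikan, hi, if_false, secondHalf_joinOutcome]
  simp only [this]
  refine bhattacharyya_le_of_factorsThrough (tripleWeight_nonneg hp hw) _ ?_
  intro ω ω' hω
  simp only [Prod.mk.injEq] at hω ⊢
  have h2 := past_halves_eq hω.1
  have h3 := xor_halves_eq hi hω.1
  simp only [firstHalf_joinOutcome, secondHalf_joinOutcome] at h2 h3
  exact ⟨h3, ⟨h2.1, hω.2.1⟩, h2.2, hω.2.2⟩

/-- Both halves have the same input length, so the length difference behaves like a sum of
independent symmetric steps in `{-1, 0, 1}`. One step has moment generating function `δ² + (1-δ)² +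
2δ(1-δ) cosh c`, at most `cosh c ≤ exp (c²/2)`. -/
theorem sum_tripleWeight_exp_le (h0 : 0 ≤ δ) (h1 : δ ≤ 1) (c : ℝ) :
    ∑ ω : Outcome ξ n₀ n × (Fin (midLen ξ n₀ n) → Bool) × Outcome ξ n₀ n,
      tripleWeight (outcomeProb H δ ξ n₀ n) (fun e => delWeight δ (List.ofFn e)) ω *
        Real.exp (c * ((outWord ω.1).length - (outWord ω.2.2).length))
      ≤ Real.exp (fullLen ξ n₀ n * (c ^ 2 / 2)) := by
  have e1 : ∀ ω : Outcome ξ n₀ n × (Fin (midLen ξ n₀ n) → Bool) × Outcome ξ n₀ n,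
      Real.exp (c * ((outWord ω.1).length - (outWord ω.2.2).length))
      = Real.exp c ^ (outWord ω.1).length * 1 * Real.exp (-c) ^ (outWord ω.2.2).length := by
    intro ω
    rw [← Real.exp_nat_mul, ← Real.exp_nat_mul, mul_one, ← Real.exp_add]
    congr 1
    ring
  simp only [e1]
  rw [sum_tripleWeight_mul (outcomeProb H δ ξ n₀ n)
    (fun e : Fin (midLen ξ n₀ n) → Bool => delWeight δ (List.ofFn e))
    (fun ω => Real.exp c ^ (outWord ω).length) (fun _ => 1)
    (fun ω => Real.exp (-c) ^ (outWord ω).length)]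
  simp only [sum_outcomeProb_mul_pow_length, mul_one, sum_delWeight_ofFn]
  rw [← mul_pow, Real.exp_nat_mul]
  have hc : Real.exp c * Real.exp (-c) = 1 := by rw [← Real.exp_add]; simp
  have h2 := Real.one_le_cosh c
  have h3 := Real.cosh_le_exp_half_sq c
  rw [Real.cosh_eq] at h2 h3
  have h4 : (δ + (1 - δ) * Real.exp c) * (δ + (1 - δ) * Real.exp (-c))
      = δ ^ 2 + (1 - δ) ^ 2 + 2 * (δ * (1 - δ)) * ((Real.exp c + Real.exp (-c)) / 2) := by
    linear_combination (1 - δ) ^ 2 * hc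
  have h5 : ∀ x, 0 ≤ δ + (1 - δ) * Real.exp x := fun x =>
    add_nonneg h0 (mul_nonneg (sub_nonneg.2 h1) (Real.exp_pos x).le)
  refine pow_le_pow_left₀ (mul_nonneg (h5 _) (h5 _)) ?_ _
  rw [h4]
  nlinarith [sq_nonneg (δ - 1 / 2), sq_nonneg δ, sq_nonneg (1 - δ)]

theorem prob_length_sub_le (h0 : 0 ≤ δ) (h1 : δ ≤ 1) {t L : ℝ} (ht : 0 ≤ t) (hL : 0 < L)
    (hfull : (fullLen ξ n₀ n : ℝ) ≤ L) (σ : ℝ) (hσ : σ ^ 2 = 1) :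
    prob (tripleWeight (outcomeProb H δ ξ n₀ n)
        (fun e : Fin (midLen ξ n₀ n) → Bool => delWeight δ (List.ofFn e)))
      (fun ω => t < σ * ((outWord ω.1).length - (outWord ω.2.2).length))
      ≤ Real.exp (-(t ^ 2 / (2 * L))) := by
  have hp := outcomeProb_nonneg (H := H) (ξ := ξ) (n₀ := n₀) (n := n) h0 h1
  have hw : ∀ e : Fin (midLen ξ n₀ n) → Bool, 0 ≤ delWeight δ (List.ofFn e) :=
    fun e => delWeight_nonneg h0 h1 _
  have hle := prob_le_sum_mul (tripleWeight_nonneg hp hw)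
    (E := fun ω => t < σ * ((outWord ω.1).length - (outWord ω.2.2).length))
    -- Exponential Markov with the optimal tilt `t / L`; the sign `σ` selects the tail.
    (f := fun ω => Real.exp (-(t ^ 2 / L)) *
      Real.exp (t / L * σ * ((outWord ω.1).length - (outWord ω.2.2).length)))
    (fun ω => by positivity) (by
      intro ω h
      rw [← Real.exp_add]
      apply Real.one_le_exp
      have : t / L * t ≤ t / L * (σ * ((outWord ω.1).length - (outWord ω.2.2).length)) :=
        mul_le_mul_of_nonneg_left h.le (by positivity)
      have e : t / L * t = t ^ 2 / L := by ring
      linarith)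
  refine hle.trans ?_
  have hs := sum_tripleWeight_exp_le (H := H) (ξ := ξ) (n₀ := n₀) (n := n) h0 h1 (t / L * σ)
  have e2 : ∀ a b c : ℝ, a * (b * c) = b * (a * c) := fun a b c => by ring
  simp only [e2, ← Finset.mul_sum]
  refine (mul_le_mul_of_nonneg_left hs (Real.exp_pos _).le).trans ?_
  rw [← Real.exp_add, Real.exp_le_exp, mul_pow, hσ]
  have : (fullLen ξ n₀ n : ℝ) * ((t / L) ^ 2 * 1 / 2) ≤ L * ((t / L) ^ 2 * 1 / 2) :=
    mul_le_mul_of_nonneg_right hfull (by positivity)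
  have e3 : -(t ^ 2 / L) + L * ((t / L) ^ 2 * 1 / 2) = -(t ^ 2 / (2 * L)) := by
    field_simp
    ring
  linarith

/-- A Chernoff bound with tilt `-1`: the moment is `exp (-2ηk)`, and the threshold `ηk` uses up half
of that exponent. -/
theorem prob_guardWord_le (h0 : 0 ≤ δ) (h1 : δ ≤ 1) {η : ℝ}
    (hη : δ + (1 - δ) * Real.exp (-1) = Real.exp (-(2 * η))) (k : ℕ) :
    prob (fun e : Fin k → Bool => delWeight δ (List.ofFn e))
      (fun e => ((guardWord e).length : ℝ) < η * k) ≤ Real.exp (-(η * k)) := by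
  have hle := prob_le_sum_mul
    (p := fun e : Fin k → Bool => delWeight δ (List.ofFn e)) (fun e => delWeight_nonneg h0 h1 _)
    (E := fun e => ((guardWord e).length : ℝ) < η * k)
    (f := fun e => Real.exp (η * k) * Real.exp (-1) ^ (guardWord e).length)
    (fun ω => by positivity) (by
      intro e h
      rw [← Real.exp_nat_mul, ← Real.exp_add]
      apply Real.one_le_exp
      linarith)
  refine hle.trans ?_
  have e2 : ∀ a b c : ℝ, a * (b * c) = b * (a * c) := fun a b c => by ring
  simp only [e2, ← Finset.mul_sum]
  have := wordSum_delWeight_mul_pow_length δ (Real.exp (-1)) (List.replicate k false)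
  rw [List.length_replicate, hη] at this
  change _ * wordSum k (fun d => delWeight δ d *
    Real.exp (-1) ^ (survivors (List.replicate k false) d).length) ≤ _
  rw [this, ← Real.exp_nat_mul, ← Real.exp_add]
  apply le_of_eq
  congr 1
  ring

/-- Both trimmed parts can be recovered from the trimmed output, up to a small probability of
error. -/
theorem zFull_le (h0 : 0 ≤ δ) (h1 : δ ≤ 1)
    (hst : ∀ s', ∑ s, H.init s * H.trans s s' = H.init s') {ρ : ℝ}
    (hρ : ∀ L, wordSum L (fun w => H.wordProb w * δ ^ w.count true) ≤ ρ ^ L)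
    {η : ℝ} (hη0 : 0 ≤ η) (hη : δ + (1 - δ) * Real.exp (-1) = Real.exp (-(2 * η)))
    (h : n₀ ≤ n) {j : ℕ} (hj : j ≤ n) {L : ℝ} (hL : 0 < L) (hfull : (fullLen ξ n₀ n : ℝ) ≤ L)
    (hjl : (fullLen ξ n₀ j : ℝ) ≤ η * guardLen ξ (n + 1) / 2) (i : Fin (2 ^ (n + 1))) :
    zFull H δ ξ n₀ (n + 1) i ≤ zPair H δ ξ n₀ n i +
      6 * √(2 * ρ ^ 2 ^ j + 2 * Real.exp (-((η * guardLen ξ (n + 1) / 2) ^ 2 / (2 * L)))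
        + Real.exp (-(η * guardLen ξ (n + 1)))) := by
  have hp := outcomeProb_nonneg (H := H) (ξ := ξ) (n₀ := n₀) (n := n) h0 h1
  have hw : ∀ e : Fin (midLen ξ n₀ n) → Bool, 0 ≤ delWeight δ (List.ofFn e) :=
    fun e => delWeight_nonneg h0 h1 _
  have hs := sum_outcomeProb (H := H) (δ := δ) (ξ := ξ) (n₀ := n₀) (n := n)
  have hws := sum_delWeight_ofFn (δ := δ) (midLen ξ n₀ n)
  have hm := midLen_of_le (ξ := ξ) h
  rw [← hm] at hjl ⊢
  set t := η * midLen ξ n₀ n / 2 with ht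
  set a := fullLen ξ n₀ j with ha
  set P := tripleWeight (outcomeProb H δ ξ n₀ n)
    (fun e : Fin (midLen ξ n₀ n) → Bool => delWeight δ (List.ofFn e)) with hP
  have hP0 : ∀ ω, 0 ≤ P ω := tripleWeight_nonneg hp hw
  have ht0 : 0 ≤ t := by positivity
  set bad : Outcome ξ n₀ n × (Fin (midLen ξ n₀ n) → Bool) × Outcome ξ n₀ n → Prop := fun ω =>
    ((true ∉ (outWord ω.1).take a ∨ true ∉ (outWord ω.2.2).reverse.take a) ∨
      (t < 1 * ((outWord ω.1).length - (outWord ω.2.2).length) ∨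
        t < -1 * ((outWord ω.1).length - (outWord ω.2.2).length))) ∨
      ((guardWord ω.2.1).length : ℝ) < η * midLen ξ n₀ n with hbad
  have hprob : prob P bad ≤ 2 * ρ ^ 2 ^ j + 2 * Real.exp (-(t ^ 2 / (2 * L)))
      + Real.exp (-(η * midLen ξ n₀ n)) := by
    have b1 := prob_no_true_take_le (ξ := ξ) (n₀ := n₀) h0 h1 hρ hj
    have b2 := prob_no_true_reverse_take_le (ξ := ξ) (n₀ := n₀) h0 h1 hst hρ hj
    rw [← prob_tripleWeight_fst hs hws] at b1
    rw [← prob_tripleWeight_snd hs hws] at b2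
    have b3 := prob_length_sub_le (H := H) h0 h1 ht0 hL hfull 1 (by norm_num)
    have b4 := prob_length_sub_le (H := H) h0 h1 ht0 hL hfull (-1) (by norm_num)
    have b5 := prob_guardWord_le h0 h1 hη (midLen ξ n₀ n)
    rw [← prob_tripleWeight_mid hs] at b5
    have c1 := prob_or_le hP0 (fun ω => true ∉ (outWord ω.1).take a)
      (fun ω => true ∉ (outWord ω.2.2).reverse.take a)
    have c2 := prob_or_le hP0
      (fun ω => t < 1 * ((outWord ω.1).length - (outWord ω.2.2).length : ℝ))
      (fun ω => t < -1 * ((outWord ω.1).length - (outWord ω.2.2).length : ℝ))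
    have c3 := prob_or_le hP0
      (fun ω => true ∉ (outWord ω.1).take a ∨ true ∉ (outWord ω.2.2).reverse.take a)
      (fun ω => t < 1 * ((outWord ω.1).length - (outWord ω.2.2).length : ℝ) ∨
        t < -1 * ((outWord ω.1).length - (outWord ω.2.2).length : ℝ))
    have c4 := prob_or_le hP0
      (fun ω => (true ∉ (outWord ω.1).take a ∨ true ∉ (outWord ω.2.2).reverse.take a) ∨
        (t < 1 * ((outWord ω.1).length - (outWord ω.2.2).length : ℝ) ∨
        t < -1 * ((outWord ω.1).length - (outWord ω.2.2).length : ℝ)))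
      (fun ω => ((guardWord ω.2.1).length : ℝ) < η * midLen ξ n₀ n)
    linarith
  rw [zPair_eq h, zFull, bhattacharyya_equiv (joinOutcome ξ n₀ n),
    outcomeProb_joinOutcome_of_le h]
  refine le_trans (bhattacharyya_le_of_factorsThrough hP0 _
    (B' := fun ω => (past (arikan (n + 1) (joinOutcome ξ n₀ n ω).1) i,
      splitMiddle (outYstar (joinOutcome ξ n₀ n ω)))) ?_) ?_
  · intro ω ω' hω
    simp only [Prod.mk.injEq] at hω ⊢
    exact ⟨hω.1, by rw [hω.2]⟩
  refine (bhattacharyya_le_add_of_eq_off hP0 (sum_tripleWeight hs hws) _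
    (B := fun ω => (past (arikan (n + 1) (joinOutcome ξ n₀ n ω).1) i, trim (outWord ω.1),
      trim (outWord ω.2.2))) (bad := bad) ?_).trans ?_
  · intro ω hω
    simp only [hbad, not_or, not_not, not_lt] at hω
    obtain ⟨⟨⟨g1, g2⟩, g3, g4⟩, g5⟩ := hω
    rw [Prod.mk.injEq]
    refine ⟨rfl, ?_⟩
    have : outYstar (joinOutcome ξ n₀ n ω)
        = trim (outWord ω.1 ++ guardWord ω.2.1 ++ outWord ω.2.2) := by
      rw [List.append_assoc, ← outWord_joinOutcome]
      rfl
    rw [this]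
    -- Off the bad event the lengths differ by at most `t`, also `a ≤ t`, and at least `2 * t` guard
    -- symbols survive: just what the cut needs.
    refine splitMiddle_trim (true_notMem_guardWord _) g1 g2 ?_ ?_
    · have : ((outWord ω.1).length + a : ℝ) ≤ (outWord ω.2.2).length + (guardWord ω.2.1).length := by
        linarith
      exact_mod_cast this
    · have : ((outWord ω.2.2).length + a : ℝ) ≤ (outWord ω.1).length + (guardWord ω.2.1).length := by
        linarith
      exact_mod_cast this
  · gcongr

end SingleStep

end TDC

/-! ### Asymptotics of guard lengths and error terms. -/

namespace TDC

open Filter Topology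

theorem guardLen_succ_le (ξ : ℝ) (n : ℕ) :
    (guardLen ξ (n + 1) : ℝ) ≤ (2 : ℝ) ^ ((1 - ξ) * n) := by
  have h := Nat.floor_le (show 0 ≤ (2 : ℝ) ^ ((1 - ξ) * (((n + 1 : ℕ) : ℝ) - 1)) by positivity)
  have e : ((n + 1 : ℕ) : ℝ) - 1 = n := by push_cast; ring
  rw [e] at h
  rwa [guardLen, e]

theorem le_guardLen_succ {ξ : ℝ} (hξ : ξ ≤ 1) (n : ℕ) :
    (2 : ℝ) ^ ((1 - ξ) * n) / 2 ≤ guardLen ξ (n + 1) := by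
  have e : ((n + 1 : ℕ) : ℝ) - 1 = n := by push_cast; ring
  rw [guardLen, e]
  set x := (2 : ℝ) ^ ((1 - ξ) * n) with hx
  have h1 : 1 ≤ x := Real.one_le_rpow one_le_two (mul_nonneg (sub_nonneg.2 hξ) n.cast_nonneg)
  have h2 := Nat.lt_floor_add_one x
  have h3 : (1 : ℝ) ≤ ⌊x⌋₊ := by exact_mod_cast (Nat.one_le_floor_iff x).2 h1
  linarith

/-- The guard-bands lengthen a word at most by a constant factor. -/
theorem exists_fullLen_le {ξ : ℝ} (hξ : 0 < ξ) :
    ∃ C : ℝ, 1 ≤ C ∧ ∀ n₀ n, (fullLen ξ n₀ n : ℝ) ≤ C * 2 ^ n := by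
  set c : ℝ := (2 : ℝ) ^ (-ξ) with hc
  have hc0 : 0 ≤ c := by positivity
  have hc1 : c < 1 := Real.rpow_lt_one_of_one_lt_of_neg one_lt_two (neg_lt_zero.2 hξ)
  refine ⟨1 + (1 - c)⁻¹, by have := sub_pos.2 hc1; linarith [inv_pos.2 this], fun n₀ n => ?_⟩
  -- Relative to the word length, the guard-band added at level `n` costs at most `c ^ n`, and these
  -- costs form a convergent geometric series.
  have key : (fullLen ξ n₀ n : ℝ) ≤ (1 + ∑ k ∈ Finset.range n, c ^ k) * 2 ^ n := by
    induction n with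
    | zero => simp [fullLen]
    | succ n ih =>
      have hmid : (midLen ξ n₀ n : ℝ) ≤ c ^ n * 2 ^ n := by
        have h1 : (guardLen ξ (n + 1) : ℝ) ≤ c ^ n * 2 ^ n := by
          refine (guardLen_succ_le ξ n).trans (le_of_eq ?_)
          rw [hc, ← Real.rpow_natCast, ← Real.rpow_natCast, ← Real.rpow_mul zero_le_two,
            ← Real.rpow_add zero_lt_two]
          congr 1
          ring
        unfold midLen
        split_ifs
        · simp; positivity
        · exact h1
      have h2 : (0 : ℝ) ≤ c ^ n * 2 ^ n := by positivity
      rw [fullLen_succ, Finset.sum_range_succ, pow_succ]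
      push_cast
      nlinarith
  refine key.trans (mul_le_mul_of_nonneg_right ?_ (by positivity))
  have := (summable_geometric_of_lt_one hc0 hc1).sum_le_tsum (Finset.range n)
    (fun k _ => pow_nonneg hc0 k)
  rw [tsum_geometric_of_lt_one hc0 hc1] at this
  linarith

theorem tendsto_two_rpow_mul_atTop {a : ℝ} (ha : 0 < a) :
    Tendsto (fun n : ℕ => (2 : ℝ) ^ (a * n)) atTop atTop := by
  have : (fun n : ℕ => (2 : ℝ) ^ (a * n)) = fun n : ℕ => ((2 : ℝ) ^ a) ^ n := by
    funext n
    rw [Real.rpow_mul zero_le_two, Real.rpow_natCast]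
  rw [this]
  exact tendsto_pow_atTop_atTop_of_one_lt (Real.one_lt_rpow one_lt_two ha)

theorem eventually_error_le {ξ κ : ℝ} (hξ : ξ < 1 / 6) (hκ : 0 < κ) :
    ∀ᶠ n : ℕ in atTop, 6 * √(5 * Real.exp (-(κ * (2 : ℝ) ^ ((1 - 2 * ξ) * n))))
      ≤ (2 : ℝ) ^ (-(((2 : ℝ) ^ (n + 1)) ^ (2 / 3 : ℝ))) := by
  have hβ : 0 < 1 - 2 * ξ - 2 / 3 := by linarith
  -- The 180 is `5 * 6²`, moved into the exponent; the 4 comes from squaring the target `exp (-2s)`,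
  -- where `2s` bounds `N^(2/3)`.
  filter_upwards [(tendsto_two_rpow_mul_atTop hβ).eventually_ge_atTop
    ((Real.log 180 + 4) / κ)] with n hn
  set s : ℝ := (2 : ℝ) ^ ((2 / 3 : ℝ) * n) with hs
  have hs1 : 1 ≤ s := Real.one_le_rpow one_le_two (by positivity)
  have e1 : (2 : ℝ) ^ ((1 - 2 * ξ) * n) = s * (2 : ℝ) ^ ((1 - 2 * ξ - 2 / 3) * n) := by
    rw [hs, ← Real.rpow_add zero_lt_two]
    congr 1
    ring
  have e2 : ((2 : ℝ) ^ (n + 1)) ^ (2 / 3 : ℝ) ≤ 2 * s := by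
    rw [hs, ← Real.rpow_natCast, ← Real.rpow_mul zero_le_two]
    calc (2 : ℝ) ^ (((n + 1 : ℕ) : ℝ) * (2 / 3)) ≤ (2 : ℝ) ^ (1 + (2 / 3 : ℝ) * n) := by
          apply Real.rpow_le_rpow_of_exponent_le one_le_two
          push_cast
          linarith
      _ = _ := by rw [Real.rpow_add zero_lt_two, Real.rpow_one]
  have e3 : Real.log 180 + 4 ≤ κ * (2 : ℝ) ^ ((1 - 2 * ξ - 2 / 3) * n) := by
    rw [div_le_iff₀ hκ] at hn
    linarith
  have e4 : (Real.log 180 + 4) * s ≤ κ * (2 : ℝ) ^ ((1 - 2 * ξ) * n) := by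
    rw [e1]
    nlinarith
  have hlog : 0 < Real.log 180 := Real.log_pos (by norm_num)
  have e5 : 5 * Real.exp (-(κ * (2 : ℝ) ^ ((1 - 2 * ξ) * n))) ≤ (Real.exp (-(2 * s)) / 6) ^ 2 := by
    rw [div_pow, ← Real.exp_nat_mul, le_div_iff₀ (by norm_num)]
    have : 5 * Real.exp (-(κ * (2 : ℝ) ^ ((1 - 2 * ξ) * n))) * 6 ^ 2
        = Real.exp (Real.log 180 + -(κ * (2 : ℝ) ^ ((1 - 2 * ξ) * n))) := by
      rw [Real.exp_add, Real.exp_log (by norm_num)]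
      ring
    rw [this, Real.exp_le_exp]
    push_cast
    nlinarith
  have e6 : √(5 * Real.exp (-(κ * (2 : ℝ) ^ ((1 - 2 * ξ) * n)))) ≤ Real.exp (-(2 * s)) / 6 :=
    (Real.sqrt_le_sqrt e5).trans_eq (Real.sqrt_sq (by positivity))
  have e7 : Real.exp (-(2 * s)) ≤ (2 : ℝ) ^ (-(((2 : ℝ) ^ (n + 1)) ^ (2 / 3 : ℝ))) := by
    rw [Real.rpow_def_of_pos zero_lt_two, Real.exp_le_exp]
    have h1 : Real.log 2 ≤ 1 := by linarith [Real.log_two_lt_d9]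
    have h2 : 0 < Real.log 2 := Real.log_pos one_lt_two
    nlinarith
  linarith

theorem exists_guard_rate {δ : ℝ} (h0 : 0 ≤ δ) (h1 : δ < 1) :
    ∃ η : ℝ, 0 < η ∧ η ≤ 1 ∧ δ + (1 - δ) * Real.exp (-1) = Real.exp (-(2 * η)) := by
  set r := δ + (1 - δ) * Real.exp (-1) with hr
  have he : Real.exp (-1) < 1 := by
    rw [← Real.exp_zero, Real.exp_lt_exp]
    norm_num
  have he0 := Real.exp_pos (-1)
  have hr1 : r < 1 := by nlinarith
  have hr0 : Real.exp (-1) ≤ r := by nlinarith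
  have hr2 : 0 < r := he0.trans_le hr0
  have hlog : -1 ≤ Real.log r := (Real.le_log_iff_exp_le hr2).2 hr0
  refine ⟨-Real.log r / 2, by linarith [Real.log_neg hr2 hr1], by linarith, ?_⟩
  rw [show -(2 * (-Real.log r / 2)) = Real.log r by ring, Real.exp_log hr2]

end TDC

/-- Bhattacharyya single-step bounds for the trimmed deletion channel. The input `X` has length
`N = 2 ^ (n + 1)`. The index `i` is counted from zero, so that its last bit is `i % 2`, and the
index `j` that belongs to `i` is `TDC.halfIndex i`. -/
theorem lemma1 (ξ : ℝ) (hξ₀ : 0 < ξ) (hξ₁ : ξ < 1 / 6) :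
    ∃ m₀ : ℕ, ∀ {S : Type*} [Fintype S] (H : HiddenMarkov S),
      H.IsRegular → H.NonDegenerate → ∀ δ : ℝ, 0 < δ → δ < 1 →
      ∃ m : ℕ, ∀ n₀ n : ℕ, m₀ ≤ n₀ → max m (n₀ + 1) ≤ n + 1 → ∀ i : Fin (2 ^ (n + 1)),
        TDC.zFull H δ ξ n₀ (n + 1) i ≤
            3 / 2 * (2 : ℝ) ^ (n + 1) * TDC.zPair H δ ξ n₀ n i
              + (2 : ℝ) ^ (-(((2 : ℝ) ^ (n + 1)) ^ (2 / 3 : ℝ))) ∧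
          3 / 2 * (2 : ℝ) ^ (n + 1) * TDC.zPair H δ ξ n₀ n i
              + (2 : ℝ) ^ (-(((2 : ℝ) ^ (n + 1)) ^ (2 / 3 : ℝ))) ≤
            if (i : ℕ) % 2 = 0 then
              3 / 2 * (2 : ℝ) ^ (n + 1) * 2 * TDC.zHalf H δ ξ n₀ n (TDC.halfIndex i)
                + (2 : ℝ) ^ (-(((2 : ℝ) ^ (n + 1)) ^ (2 / 3 : ℝ)))
            else
              3 / 2 * (2 : ℝ) ^ (n + 1) * TDC.zHalf H δ ξ n₀ n (TDC.halfIndex i) ^ 2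
                + (2 : ℝ) ^ (-(((2 : ℝ) ^ (n + 1)) ^ (2 / 3 : ℝ))) := by
  obtain ⟨C, hC1, hC⟩ := TDC.exists_fullLen_le hξ₀
  -- All estimates are uniform in `n₀`, including the constant `C`, so the threshold for `n₀` can be
  -- 0.
  refine ⟨0, fun {S} _ H hH hnd δ hδ0 hδ1 => ?_⟩
  obtain ⟨ρ, hρ0, hρ1, hρ⟩ := HiddenMarkov.exists_ones_decay hH hnd hδ0.le hδ1
  obtain ⟨η, hη0, hη1, hη⟩ := TDC.exists_guard_rate hδ0.le hδ1
  set θ := -Real.log ρ with hθ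
  have hθ0 : 0 < θ := neg_pos.2 (Real.log_neg hρ0 hρ1)
  have hC0 : 0 < C := one_pos.trans_le hC1
  -- The three entries are the rates for missing outer ones, for the length difference and for the
  -- guard-band.
  set κ := min (min (θ * η / (4 * C)) (η ^ 2 / (8 * C))) η with hκ
  have hκ0 : 0 < κ := by
    refine lt_min (lt_min ?_ ?_) hη0 <;> positivity
  have ev := (TDC.eventually_error_le hξ₁ (show 0 < κ / 4 by positivity)).and
    ((TDC.tendsto_two_rpow_mul_atTop (show 0 < 1 - ξ by linarith)).eventually_ge_atTop
      (4 * C / η))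
  obtain ⟨M, hM⟩ := Filter.eventually_atTop.1 ev
  refine ⟨M + 1, fun n₀ n _ hn i => ?_⟩
  have hn₀ : n₀ ≤ n := by have := (le_max_right _ _).trans hn; omega
  obtain ⟨herr, hbig⟩ := hM n (by have := (le_max_left _ _).trans hn; omega)
  have hZ0 : 0 ≤ TDC.zPair H δ ξ n₀ n i := TDC.bhattacharyya_nonneg _ _ _
  have hN : (1 : ℝ) ≤ 2 ^ (n + 1) := one_le_pow₀ one_le_two
  refine ⟨?_, ?_⟩
  · set l : ℝ := ((TDC.guardLen ξ (n + 1) : ℕ) : ℝ) with hl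
    have hl1 := TDC.le_guardLen_succ (show ξ ≤ 1 by linarith) n
    have hl2 := TDC.guardLen_succ_le ξ n
    rw [← hl] at hl1 hl2
    have hl0 : 0 ≤ l := Nat.cast_nonneg _
    have hln : l ≤ 2 ^ n := by
      refine hl2.trans ?_
      rw [← Real.rpow_natCast]
      apply Real.rpow_le_rpow_of_exponent_le one_le_two
      nlinarith [(n.cast_nonneg : (0 : ℝ) ≤ n)]
    have hx1 : 1 ≤ η * l / (2 * C) := by
      rw [div_le_iff₀ hη0] at hbig
      rw [le_div_iff₀ (by positivity)]
      nlinarith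
    -- `2 ^ j` is the power of two nearest below `η * l / (2 * C)`: small enough that the ends
    -- searched for a `1` fit into half of the surviving guard, yet proportional to `l`, so that
    -- missing ones stay exponentially unlikely in `l`.
    obtain ⟨j, hj1, hj2⟩ := exists_nat_pow_near hx1 (one_lt_two : (1 : ℝ) < 2)
    have hjn : j ≤ n := by
      have h1 : (2 : ℝ) ^ j ≤ 2 ^ n := by
        refine hj1.trans (le_trans ?_ hln)
        rw [div_le_iff₀ (by positivity)]
        nlinarith
      exact (pow_le_pow_iff_right₀ (one_lt_two : (1 : ℝ) < 2)).1 h1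
    have hjl : (TDC.fullLen ξ n₀ j : ℝ) ≤ η * l / 2 := by
      refine (hC n₀ j).trans ?_
      rw [le_div_iff₀ (by positivity)] at hj1
      linarith
    have main := TDC.zFull_le hδ0.le hδ1.le hH.stationary hρ hη0.le hη hn₀ hjn
      (show 0 < C * 2 ^ n by positivity) (hC n₀ n) hjl i
    rw [← hl] at main
    -- As `l ≤ 2 ^ n`, also `q ≤ l`: the length-difference exponent is the weakest, and the other
    -- two error terms are relaxed to it.
    set q : ℝ := l ^ 2 / 2 ^ n with hq
    have hql : q ≤ l := by
      rw [hq, div_le_iff₀ (by positivity)]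
      nlinarith
    have hq0 : 0 ≤ q := by positivity
    have b1 : ρ ^ 2 ^ j ≤ Real.exp (-(κ * q)) := by
      have e : ρ ^ 2 ^ j = Real.exp (-(θ * 2 ^ j)) := by
        rw [hθ, neg_mul, neg_neg, ← Real.exp_log (pow_pos hρ0 (2 ^ j)), Real.log_pow]
        push_cast
        rw [mul_comm]
      rw [e, Real.exp_le_exp, neg_le_neg_iff]
      have h1 : η * l / (4 * C) ≤ 2 ^ j := by
        rw [pow_succ, div_lt_iff₀ (by positivity)] at hj2
        rw [div_le_iff₀ (by positivity)]
        linarith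
      calc κ * q ≤ θ * η / (4 * C) * l := by
            refine mul_le_mul ((min_le_left _ _).trans (min_le_left _ _)) hql hq0 (by positivity)
        _ = θ * (η * l / (4 * C)) := by ring
        _ ≤ θ * 2 ^ j := mul_le_mul_of_nonneg_left h1 hθ0.le
    have b2 : Real.exp (-((η * l / 2) ^ 2 / (2 * (C * 2 ^ n)))) ≤ Real.exp (-(κ * q)) := by
      rw [Real.exp_le_exp, neg_le_neg_iff]
      calc κ * q ≤ η ^ 2 / (8 * C) * q :=
            mul_le_mul_of_nonneg_right ((min_le_left _ _).trans (min_le_right _ _)) hq0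
        _ = _ := by rw [hq]; field_simp; ring
    have b3 : Real.exp (-(η * l)) ≤ Real.exp (-(κ * q)) := by
      rw [Real.exp_le_exp, neg_le_neg_iff]
      exact mul_le_mul (min_le_right _ _) hql hq0 hη0.le
    have hqr : κ / 4 * (2 : ℝ) ^ ((1 - 2 * ξ) * n) ≤ κ * q := by
      have e : ((2 : ℝ) ^ ((1 - ξ) * n) / 2) ^ 2 = (2 : ℝ) ^ ((1 - 2 * ξ) * n) / 4 * 2 ^ n := by
        rw [div_pow, ← Real.rpow_natCast, ← Real.rpow_mul zero_le_two, ← Real.rpow_natCast 2 n,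
          div_mul_eq_mul_div, ← Real.rpow_add zero_lt_two]
        congr 1
        · congr 1
          push_cast
          ring
        · norm_num
      have h2 : (2 : ℝ) ^ ((1 - 2 * ξ) * n) / 4 ≤ q := by
        rw [hq, le_div_iff₀ (by positivity), ← e]
        gcongr
      calc _ = κ * ((2 : ℝ) ^ ((1 - 2 * ξ) * n) / 4) := by ring
        _ ≤ _ := mul_le_mul_of_nonneg_left h2 hκ0.le
    have b4 : Real.exp (-(κ * q)) ≤ Real.exp (-(κ / 4 * (2 : ℝ) ^ ((1 - 2 * ξ) * n))) := by
      rw [Real.exp_le_exp, neg_le_neg_iff]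
      exact hqr
    have b5 : 6 * √(2 * ρ ^ 2 ^ j + 2 * Real.exp (-((η * l / 2) ^ 2 / (2 * (C * 2 ^ n))))
        + Real.exp (-(η * l))) ≤ (2 : ℝ) ^ (-(((2 : ℝ) ^ (n + 1)) ^ (2 / 3 : ℝ))) := by
      refine le_trans ?_ herr
      refine mul_le_mul_of_nonneg_left (Real.sqrt_le_sqrt ?_) (by norm_num)
      linarith
    -- `main` has coefficient 1 in front of `zPair`, which is at most `3 / 2 * 2 ^ (n + 1)`.
    nlinarith
  · split_ifs with hi
    · have := TDC.zPair_le_of_even hδ0.le hδ1.le hn₀ (H := H) (ξ := ξ) hi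
      rw [mul_assoc _ (2 : ℝ) (TDC.zHalf _ _ _ _ _ _)]
      gcongr
    · have := TDC.zPair_le_of_odd hδ0.le hδ1.le hn₀ (H := H) (ξ := ξ) hi
      gcongr
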